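/- For a function $f:\mathbb{R}\to\mathbb{C}$ write $\hat f(\xi)=\int_{\mathbb{R}} f(x)e^{-2\pi i x\xi}\,dx$, and for $n\in\mathbb{N}$ put $[n]=\{j\in\mathbb{Z}: -\tfrac n2<j\le \tfrac n2\}$. An admissible weight is a function $v:\mathbb{R}\to(0,\infty)$ such that $v(-x)=v(x)$ for all $x$; $v(x)\le v(y)$ whenever $|x|\le|y|$; $v(x+y)\le v(x)v(y)$ for all $x,y$; and $\sum_{l\in\mathbb{Z}}v(l)^{-2}<\infty$. For such $v$ let $W(\mathcal{C},\ell^2_v)$ be the space of continuous $f:\mathbb{R}\to\mathbb{C}$ with $$\|f\|_{W(\mathcal{C},\ell^2_v)}=\Big(\sum_{l\in\mathbb{Z}}\sup_{x\in[0,1]}|f(x+l)|^2\,v(l)^2\Big)^{1/2}<\infty ,$$ and let $\Phi_v(p)=\big(2\sum_{m=0}^\infty v(pm+\tfrac p2)^{-2}\big)^{1/2}$ for $p>0$. Let $B_0(x)=\frac{\sin \pi x}{\pi x}$ (with $B_0(0)=1$), $B_1=\mathbf{1}_{[-1/2,1/2)}$, $B_2(x)=(1-|x|)\mathbf{1}_{[-1,1]}(x)$,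 and $v_\alpha(x)=(1+|x|)^\alpha$. **Theorem.** (a) Let $v,w$ be admissible weights. There is a constant $C>0$, depending only on $v$ and $w$, such that for all $f\in W(\mathcal{C},\ell^2_v)$ with $\hat f\in W(\mathcal{C},\ell^2_w)$, all $n\in\mathbb{N}$ and all real $h,p$ with $0<h\le 1\le p$ and $p=hn$, $$\Big\|\hat f-h\sum_{k,j\in[n]}f(hj)\,e^{-2\pi i\frac{kj}{n}}\,B_0(p\,\cdot-k)\Big\|_{L^2(\mathbb{R})}\le C\Big(\Phi_v(p)\,\|f\|_{W(\mathcal{C},\ell^2_v)}+\Phi_w(h^{-1})\,\|\hat f\|_{W(\mathcal{C},\ell^2_w)}\Big).$$ (b) Let $i\in\{1,2\}$, let $\tfrac12<\alpha\le i$, and let $w$ be an admissible weight. Then the statement of (a) holds for $v=v_\alpha$ with $B_0$ replaced by $B_i$, with a constant $C>0$ that depends only on $i$, $\alpha$ and $w$. -/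

import Mathlib

open scoped FourierTransform

/-- The symmetric index set `[n] = {j ∈ ℤ : -n/2 < j ≤ n/2}`. -/
noncomputable def symIndex (n : ℕ) : Finset ℤ :=
  (Finset.Icc (-(n : ℤ)) n).filter (fun j => -(n : ℤ) < 2 * j ∧ 2 * j ≤ n)

theorem mem_symIndex (n : ℕ) (j : ℤ) :
    j ∈ symIndex n ↔ -((n : ℝ) / 2) < (j : ℝ) ∧ (j : ℝ) ≤ (n : ℝ) / 2 := by
  have h1 : -((n : ℝ) / 2) < (j : ℝ) ↔ -(n : ℤ) < 2 * j := by
    rw [← Int.cast_lt (R := ℝ)]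
    push_cast
    constructor <;> intro h <;> linarith
  have h2 : (j : ℝ) ≤ (n : ℝ) / 2 ↔ 2 * j ≤ (n : ℤ) := by
    rw [← Int.cast_le (R := ℝ)]
    push_cast
    constructor <;> intro h <;> linarith
  rw [h1, h2]
  simp only [symIndex, Finset.mem_filter, Finset.mem_Icc]
  omega

/-- Admissible weights `v : ℝ → (0, ∞)`: even, nondecreasing in `|x|`, submultiplicative, and
inverse square-summable over the integers. -/
structure IsAdmissibleWeight (v : ℝ → ℝ) : Prop where
  pos : ∀ x, 0 < v x
  even : ∀ x, v (-x) = v x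
  mono : ∀ x y, |x| ≤ |y| → v x ≤ v y
  submul : ∀ x y, v (x + y) ≤ v x * v y
  summable_inv_sq : Summable (fun l : ℤ => (v (l : ℝ) ^ 2)⁻¹)

/-- The polynomial weight `v_α(x) = (1 + |x|)^α`. -/
noncomputable def polyWeight (α : ℝ) (x : ℝ) : ℝ := (1 + |x|) ^ α

/-- `sup_{x ∈ [0,1]} |f (x + l)|` (a maximum when `f` is continuous). -/
noncomputable def localSup (f : ℝ → ℂ) (l : ℤ) : ℝ :=
  ⨆ x : Set.Icc (0 : ℝ) 1, ‖f ((x : ℝ) + (l : ℝ))‖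

/-- Membership in the Wiener amalgam space `W(C, ℓ²_v)`: `f` is continuous and its amalgam norm
is finite. -/
def MemWiener (v : ℝ → ℝ) (f : ℝ → ℂ) : Prop :=
  Continuous f ∧ Summable (fun l : ℤ => localSup f l ^ 2 * v (l : ℝ) ^ 2)

/-- The norm of `W(C, ℓ²_v)`, meaningful for `f` with `MemWiener v f`. -/
noncomputable def wienerNorm (v : ℝ → ℝ) (f : ℝ → ℂ) : ℝ :=
  Real.sqrt (∑' l : ℤ, localSup f l ^ 2 * v (l : ℝ) ^ 2)

/-- `Φ_v(p) = (2 ∑_{m ≥ 0} v(p m + p/2)⁻²)^{1/2}`. The series converges for every admissible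
weight and every `p > 0`. -/
noncomputable def tailPhi (v : ℝ → ℝ) (p : ℝ) : ℝ :=
  Real.sqrt (2 * ∑' m : ℕ, (v (p * (m : ℝ) + p / 2) ^ 2)⁻¹)

/-- The cardinal sine `sin (π x) / (π x)`, with value `1` at `0`. -/
noncomputable def cardinalSinc (x : ℝ) : ℝ := Real.sinc (Real.pi * x)

/-- The first B-spline, the indicator function of `[-1/2, 1/2)`. -/
noncomputable def bsplineOne : ℝ → ℝ :=
  Set.indicator (Set.Ico (-(1 / 2) : ℝ) (1 / 2)) (fun _ => 1)

/-- The second B-spline, the hat function `(1 - |x|) 1_{[-1, 1]}(x)`. -/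
noncomputable def bsplineTwo : ℝ → ℝ :=
  Set.indicator (Set.Icc (-1 : ℝ) 1) (fun x => 1 - |x|)

/-- The interpolation with `φ` of the scaled discrete Fourier transform of the samples `f(hj)`:
`ξ ↦ h ∑_{k,j ∈ [n]} f(hj) e^{-2πi kj/n} φ(pξ - k)`. -/
noncomputable def dftInterpolant (φ : ℝ → ℝ) (f : ℝ → ℂ) (h p : ℝ) (n : ℕ) (ξ : ℝ) : ℂ :=
  (h : ℂ) * ∑ k ∈ symIndex n, ∑ j ∈ symIndex n,
    f (h * (j : ℝ)) * Complex.exp (-2 * Real.pi * Complex.I * ((k : ℂ) * (j : ℂ) / (n : ℂ)))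
      * (φ (p * ξ - (k : ℝ)) : ℂ)

/-!
The discrete Fourier transform of the samples `f (h j)` is compared with `𝓕 f` on the other side of
the Fourier transform. Suppose the interpolating function `φ` and a function `ψ` form a Fourier
pair: `cardinalSinc` with the indicator of `(-1/2, 1/2]`, `bsplineOne` with `cardinalSinc`,
`bsplineTwo` with `cardinalSinc ^ 2`. By Plancherel the `L²` error equals
`‖f - ψ (· / p) T (· / p)‖`, where `T` is the trigonometric polynomial of period one with
coefficients `p⁻¹ c k`, `c` being the scaled discrete Fourier transform
(`eLpNorm_fourier_sub_dftInterpolant_of_fourier_eq` when `ψ` is integrable,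
`eLpNorm_fourier_sub_dftInterpolant_of_fourierInv_eq` when `φ` is).

Put `u t = f (p t)`, let `P t = ∑ m, u (t + m)` be its periodization, and cut the line into the
translates of `J = (-1/2, 1/2]`. For `t ∈ J` the quantity `∑ m, |u (t + m) - ψ (t + m) T t|²` is
controlled by three things: the tail of `u` away from `J`, which Cauchy-Schwarz bounds by
`tailPhi v p` times a weighted energy (`IsAdmissibleWeight.enorm_tsum_sq_le`); the defect
`|1 - ψ t|² + ∑ m ≠ 0, |ψ (t + m)|²` times `|u t|²`; and `|P t - T t|²`. The defect vanishes for
the indicator, and for the two spline cases it is `O(|t| ^ (2 α))`, which for the polynomial weight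
is again dominated by `tailPhi v p ^ 2 * v (p t) ^ 2`. This is where `α ≤ 1`, respectively
`α ≤ 2`, enters. The predicate `IsPeriodizationKernel` records what is needed of `ψ`, and
`IsPeriodizationKernel.lintegral_enorm_sub_sq_le` is the resulting integrated estimate.

By Parseval on the circle (`lintegral_periodization_sub_trigPoly`), what remains is
`p⁻¹ ∑ k, |𝓕 f (k / p) - c k|²` with `c k` replaced by zero off `[n]`. Poisson summation
(`dftCoeff_add_alias`) writes the error for `k ∈ [n]` as the difference of the aliasing tail of
`𝓕 f`, with spacing `1 / h`, and the discrete Fourier transform of the tails of `f`, with spacing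
`p`. The Cauchy-Schwarz tail bound and the Parseval identity on `[n]` reduce this to sampled
energies `δ ∑ k, |f (δ k)|² v (δ k)²`, which the amalgam norm bounds (`tsum_sample_le`); the outcome is
`tsum_fourier_sub_dftCoeff_le`. All three cases are then instances of
`IsPeriodizationKernel.eLpNorm_sub_le`.
-/

open MeasureTheory Set

/-! ### Plancherel and transfer of the error -/

/-- **Plancherel's theorem** on `L¹ ∩ L²`: the integral Fourier transform preserves the `L²` norm.
Tested against Schwartz functions it agrees with the Fourier transform of the `L²` class. -/
theorem eLpNorm_fourier_eq {u : ℝ → ℂ} (h1 : Integrable u) (h2 : MemLp u 2) :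
    eLpNorm (𝓕 u) 2 volume = eLpNorm u 2 volume := by
  set U : Lp ℂ 2 (volume : Measure ℝ) := h2.toLp u with hU
  have hcont : Continuous (𝓕 u) :=
    VectorFourier.fourierIntegral_continuous Real.continuous_fourierChar
      (by exact continuous_inner) h1
  have key : ∀ g : SchwartzMap ℝ ℂ,
      ∫ x, g x * (𝓕 U : Lp ℂ 2 (volume : Measure ℝ)) x = ∫ x, g x * 𝓕 u x := by
    intro g
    have e1 := congrArg (fun D => D g) (Lp.fourier_toTemperedDistribution_eq U)
    simp only [TemperedDistribution.fourier_apply, Lp.toTemperedDistribution_apply,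
      smul_eq_mul] at e1
    rw [← e1]
    have e2 := VectorFourier.integral_bilin_fourierIntegral_eq_flip
      (ContinuousLinearMap.mul ℂ ℂ) (μ := volume) (ν := volume) (L := innerₗ ℝ)
      Real.continuous_fourierChar (by exact continuous_inner) g.integrable h1
    have e3 : ∫ x, (𝓕 g : SchwartzMap ℝ ℂ) x * U x = ∫ x, 𝓕 (g : ℝ → ℂ) x * u x := by
      apply integral_congr_ae
      filter_upwards [h2.coeFn_toLp] with x hx
      rw [hU, hx]; rfl
    rw [e3]
    simpa using! e2
  have hae : (𝓕 U : Lp ℂ 2 (volume : Measure ℝ)) =ᵐ[volume] 𝓕 u := by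
    apply ae_eq_of_integral_contDiff_smul_eq
    · exact (Lp.memLp _).locallyIntegrable (by norm_num)
    · exact hcont.locallyIntegrable
    · intro g hg hgc
      have hgc' : HasCompactSupport (fun x => (g x : ℂ)) :=
        hgc.comp_left (g := fun x : ℝ => (x : ℂ)) (by simp)
      have hg' : ContDiff ℝ (⊤ : ℕ∞) (fun x => (g x : ℂ)) :=
        Complex.ofRealCLM.contDiff.comp hg
      have := key (hgc'.toSchwartzMap hg')
      simpa using! this
  rw [← eLpNorm_congr_ae hae, ← eLpNorm_congr_ae h2.coeFn_toLp]
  have := Lp.norm_fourier_eq U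
  rw [Lp.norm_def, Lp.norm_def, ENNReal.toReal_eq_toReal_iff' (Lp.eLpNorm_ne_top _)
    (Lp.eLpNorm_ne_top _)] at this
  exact this

/-- Plancherel's theorem on `L¹ ∩ L²` for the inverse Fourier transform. -/
theorem eLpNorm_fourierInv_eq {u : ℝ → ℂ} (h1 : Integrable u) (h2 : MemLp u 2) :
    eLpNorm (𝓕⁻ u) 2 volume = eLpNorm u 2 volume := by
  have h : 𝓕⁻ u = (𝓕 u) ∘ (fun x => -x) := by
    ext x; exact Real.fourierInv_eq_fourier_neg u x
  rw [h, eLpNorm_comp_measurePreserving _ (Measure.measurePreserving_neg volume),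
    eLpNorm_fourier_eq h1 h2]
  exact (VectorFourier.fourierIntegral_continuous Real.continuous_fourierChar
      (by exact continuous_inner) h1).aestronglyMeasurable

theorem fourier_dilate_modulate (ψ : ℝ → ℂ) {p : ℝ} (hp : 0 < p) (k : ℤ) (ξ : ℝ) :
    𝓕 (fun x : ℝ => ψ (x / p) * Complex.exp (2 * Real.pi * Complex.I * (k * (x / p)))) ξ
      = p * 𝓕 ψ (p * ξ - k) := by
  rw [Real.fourier_real_eq_integral_exp_smul, Real.fourier_real_eq_integral_exp_smul]
  have := Measure.integral_comp_div (fun t : ℝ =>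
    Complex.exp (↑(-2 * Real.pi * t * (p * ξ - k)) * Complex.I) • ψ t) p
  rw [abs_of_pos hp, Complex.real_smul] at this
  rw [← this]
  congr 1 with x
  have hp' : (p : ℂ) ≠ 0 := by exact_mod_cast hp.ne'
  simp only [smul_eq_mul]
  rw [mul_left_comm, ← Complex.exp_add, mul_comm]
  congr 2
  push_cast
  field_simp
  ring

theorem fourierInv_dilate_translate (φ : ℝ → ℂ) {p : ℝ} (hp : 0 < p) (k : ℤ) (x : ℝ) :
    𝓕⁻ (fun ξ : ℝ => φ (p * ξ - k)) x
      = (p : ℂ)⁻¹ * (𝓕⁻ φ (x / p) * Complex.exp (2 * Real.pi * Complex.I * (k * (x / p)))) := by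
  rw [Real.fourierInv_eq', Real.fourierInv_eq']
  have h1 := Measure.integral_comp_mul_left (fun s : ℝ =>
    Complex.exp (↑(2 * Real.pi * ((s) * (x / p))) * Complex.I) • φ (s - k)) p
  rw [abs_of_pos (inv_pos.2 hp), Complex.real_smul] at h1
  have h2 := integral_sub_right_eq_self (μ := volume) (fun s : ℝ =>
    Complex.exp (↑(2 * Real.pi * ((s + k) * (x / p))) * Complex.I) • φ s) (k : ℝ)
  have hp' : (p : ℂ) ≠ 0 := by exact_mod_cast hp.ne'
  calc _ = ∫ ξ, Complex.exp (↑(2 * Real.pi * ((p * ξ) * (x / p))) * Complex.I) •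
        φ (p * ξ - k) := by
        congr 1 with ξ
        congr 4
        simp only [RCLike.inner_apply, conj_trivial]
        field_simp
    _ = _ := by
        rw [h1]
        push_cast
        congr 1
        rw [← integral_mul_const]
        rw [show (∫ s : ℝ, Complex.exp (2 * Real.pi * (s * (x / p)) * Complex.I) • φ (s - k))
          = ∫ s : ℝ, Complex.exp (↑(2 * Real.pi * ((s + k) * (x / p))) * Complex.I) • φ s by
            rw [← h2]; congr 1 with s; push_cast; congr 3; ring]
        congr 1 with s
        simp only [smul_eq_mul, RCLike.inner_apply, conj_trivial]
        rw [mul_right_comm (Complex.exp _) (φ s), ← Complex.exp_add]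
        congr 2
        push_cast
        ring_nf

/-- The scaled discrete Fourier transform `h ∑_{j ∈ [n]} f(hj) e^{-2πi kj/n}` of the samples of `f`,
defined for every integer frequency `k`; it approximates `𝓕 f (k / p)` for `k ∈ [n]` and
`p = h n`. -/
noncomputable def dftCoeff (f : ℝ → ℂ) (h : ℝ) (n : ℕ) (k : ℤ) : ℂ :=
  h * ∑ j ∈ symIndex n, f (h * (j : ℝ)) *
    Complex.exp (-2 * Real.pi * Complex.I * ((k : ℂ) * (j : ℂ) / (n : ℂ)))

theorem dftInterpolant_eq_sum_dftCoeff (φ : ℝ → ℝ) (f : ℝ → ℂ) (h p : ℝ) (n : ℕ) (ξ : ℝ) :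
    dftInterpolant φ f h p n ξ
      = ∑ k ∈ symIndex n, dftCoeff f h n k * (φ (p * ξ - (k : ℝ)) : ℂ) := by
  simp only [dftInterpolant, dftCoeff, Finset.mul_sum, Finset.sum_mul, mul_assoc]

/-- The trigonometric polynomial of period one with coefficients `p⁻¹ * dftCoeff f h n k` for
`k ∈ [n]`. It approximates the periodization of `t ↦ f (p * t)`. -/
noncomputable def dftTrigPoly (f : ℝ → ℂ) (h p : ℝ) (n : ℕ) (t : ℝ) : ℂ :=
  ∑ k ∈ symIndex n, (p : ℂ)⁻¹ * dftCoeff f h n k *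
    Complex.exp (2 * Real.pi * Complex.I * ((k : ℂ) * (t : ℂ)))

theorem MeasureTheory.MemLp.comp_mul_left_real {ψ : ℝ → ℂ} {q : ENNReal} (hψ : MemLp ψ q)
    {p : ℝ} (hp : p ≠ 0) : MemLp (fun x : ℝ => ψ (p * x)) q := by
  have h2 : MemLp ψ q (Measure.map (fun x => p * x) volume) := by
    rw [Real.map_volume_mul_left hp]; exact hψ.smul_measure ENNReal.ofReal_ne_top
  exact h2.comp_of_map (by fun_prop)

theorem memLp_dilate_modulate {ψ : ℝ → ℂ} {q : ENNReal} (hψ : MemLp ψ q) {p : ℝ} (hp : 0 < p)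
    (k : ℤ) :
    MemLp (fun x : ℝ => ψ (x / p) * Complex.exp (2 * Real.pi * Complex.I * (k * (x / p)))) q := by
  have h1 : MemLp (fun x : ℝ => ψ (x / p)) q := by
    simpa only [div_eq_inv_mul] using hψ.comp_mul_left_real (inv_ne_zero hp.ne')
  refine h1.of_le (h1.1.mul (by fun_prop)) (Filter.Eventually.of_forall fun x => ?_)
  rw [norm_mul, Complex.norm_exp]
  simp

theorem memLp_dilate_translate {φ : ℝ → ℂ} {q : ENNReal} (hφ : MemLp φ q) {p : ℝ} (hp : 0 < p)
    (k : ℤ) : MemLp (fun ξ : ℝ => φ (p * ξ - k)) q :=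
  (hφ.comp_measurePreserving (measurePreserving_sub_right volume (k : ℝ))).comp_mul_left_real hp.ne'

/-- If `φ` is the Fourier transform of `ψ ∈ L¹ ∩ L²`, then the interpolant is the Fourier transform
of `ψ (x / p) * dftTrigPoly f h p n (x / p)`, and the error can be measured on the side of `f`. -/
theorem eLpNorm_fourier_sub_dftInterpolant_of_fourier_eq {ψ φ : ℝ → ℝ}
    (hψ1 : Integrable (fun x => (ψ x : ℂ))) (hψ2 : MemLp (fun x => (ψ x : ℂ)) 2)
    (hφ : ∀ ξ, 𝓕 (fun x => (ψ x : ℂ)) ξ = φ ξ) {f : ℝ → ℂ} (hf1 : Integrable f)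
    (hf2 : MemLp f 2) {h p : ℝ} (hp : 0 < p) (n : ℕ) :
    eLpNorm (fun ξ => 𝓕 f ξ - dftInterpolant φ f h p n ξ) 2 volume
      = eLpNorm (fun x => f x - ψ (x / p) * dftTrigPoly f h p n (x / p)) 2 volume := by
  have hp' : (p : ℂ) ≠ 0 := by exact_mod_cast hp.ne'
  set M : ℤ → ℝ → ℂ := fun k x =>
    (ψ (x / p) : ℂ) * Complex.exp (2 * Real.pi * Complex.I * (k * (x / p))) with hM
  have hM1 : ∀ k, Integrable (M k) := fun k => memLp_one_iff_integrable.1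
    (memLp_dilate_modulate (ψ := fun x => (ψ x : ℂ)) (memLp_one_iff_integrable.2 hψ1) hp k)
  have hM2 : ∀ k, MemLp (M k) 2 := fun k =>
    memLp_dilate_modulate (ψ := fun x => (ψ x : ℂ)) hψ2 hp k
  have hg : (fun x => f x - ψ (x / p) * dftTrigPoly f h p n (x / p))
      = fun x => f x - ∑ k ∈ symIndex n, (p : ℂ)⁻¹ * dftCoeff f h n k * M k x := by
    ext x
    simp only [dftTrigPoly, hM, Finset.mul_sum]
    congr 1
    refine Finset.sum_congr rfl fun k _ => ?_
    push_cast
    ring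
  have hS1 : Integrable (fun x => ∑ k ∈ symIndex n, (p : ℂ)⁻¹ * dftCoeff f h n k * M k x) :=
    integrable_finsetSum _ fun k _ => (hM1 k).const_mul _
  have hS2 : MemLp (fun x => ∑ k ∈ symIndex n, (p : ℂ)⁻¹ * dftCoeff f h n k * M k x) 2 :=
    memLp_finsetSum _ fun k _ => (hM2 k).const_mul _
  rw [hg]
  refine Eq.trans ?_ (eLpNorm_fourier_eq (hf1.sub hS1) (hf2.sub hS2))
  congr 1
  ext ξ
  have hchar : ∀ {u : ℝ → ℂ}, Integrable u → Integrable (fun v : ℝ =>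
      Complex.exp (↑(-2 * Real.pi * v * ξ) * Complex.I) • u v) := by
    intro u hu
    refine hu.bdd_mul (c := 1) (by fun_prop) (Filter.Eventually.of_forall fun v => ?_)
    rw [Complex.norm_exp]; simp
  rw [dftInterpolant_eq_sum_dftCoeff, Real.fourier_real_eq_integral_exp_smul,
    Real.fourier_real_eq_integral_exp_smul]
  simp only [smul_sub]
  rw [integral_sub (hchar hf1) (hchar hS1)]
  congr 1
  simp only [Finset.smul_sum]
  rw [integral_finsetSum _ fun k _ => hchar ((hM1 k).const_mul _)]
  refine Finset.sum_congr rfl fun k _ => ?_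
  have := fourier_dilate_modulate (fun x => (ψ x : ℂ)) hp k ξ
  rw [Real.fourier_real_eq_integral_exp_smul, hφ] at this
  simp only [smul_eq_mul, mul_left_comm _ ((p : ℂ)⁻¹ * _)] at this ⊢
  rw [integral_const_mul, this]
  field_simp

/-- The same identity for a `φ ∈ L¹ ∩ L²` whose inverse Fourier transform is `ψ`, which itself need
not be integrable. -/
theorem eLpNorm_fourier_sub_dftInterpolant_of_fourierInv_eq {ψ φ : ℝ → ℝ}
    (hφ1 : Integrable (fun x => (φ x : ℂ))) (hφ2 : MemLp (fun x => (φ x : ℂ)) 2)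
    (hψ : ∀ x, 𝓕⁻ (fun x => (φ x : ℂ)) x = ψ x) {f : ℝ → ℂ} (hfi : 𝓕⁻ (𝓕 f) = f)
    (hf1 : Integrable (𝓕 f)) (hf2 : MemLp (𝓕 f) 2) {h p : ℝ} (hp : 0 < p) (n : ℕ) :
    eLpNorm (fun ξ => 𝓕 f ξ - dftInterpolant φ f h p n ξ) 2 volume
      = eLpNorm (fun x => f x - ψ (x / p) * dftTrigPoly f h p n (x / p)) 2 volume := by
  have hM1 : ∀ k : ℤ, Integrable (fun ξ : ℝ => (φ (p * ξ - k) : ℂ)) := fun k =>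
    memLp_one_iff_integrable.1 (memLp_dilate_translate (φ := fun x => (φ x : ℂ))
      (memLp_one_iff_integrable.2 hφ1) hp k)
  have hM2 : ∀ k : ℤ, MemLp (fun ξ : ℝ => (φ (p * ξ - k) : ℂ)) 2 := fun k =>
    memLp_dilate_translate (φ := fun x => (φ x : ℂ)) hφ2 hp k
  simp only [dftInterpolant_eq_sum_dftCoeff]
  have hS1 : Integrable (fun ξ : ℝ => ∑ k ∈ symIndex n, dftCoeff f h n k * (φ (p * ξ - k) : ℂ)) :=
    integrable_finsetSum _ fun k _ => (hM1 k).const_mul _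
  have hS2 : MemLp (fun ξ : ℝ => ∑ k ∈ symIndex n, dftCoeff f h n k * (φ (p * ξ - k) : ℂ)) 2 :=
    memLp_finsetSum _ fun k _ => (hM2 k).const_mul _
  refine Eq.trans (eLpNorm_fourierInv_eq (hf1.sub hS1) (hf2.sub hS2)).symm ?_
  congr 1
  ext x
  have hchar : ∀ {u : ℝ → ℂ}, Integrable u → Integrable (fun v : ℝ =>
      Complex.exp (↑(2 * Real.pi * inner ℝ v x) * Complex.I) • u v) := by
    intro u hu
    refine hu.bdd_mul (c := 1) (by fun_prop) (Filter.Eventually.of_forall fun v => ?_)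
    rw [Complex.norm_exp]; simp
  have e2 := congrFun hfi x
  rw [Real.fourierInv_eq'] at e2 ⊢
  simp only [Pi.sub_apply, smul_sub]
  rw [integral_sub (hchar hf1) (hchar hS1), e2]
  congr 1
  simp only [Finset.smul_sum]
  rw [integral_finsetSum _ fun k _ => hchar ((hM1 k).const_mul _), dftTrigPoly, Finset.mul_sum]
  refine Finset.sum_congr rfl fun k _ => ?_
  have := fourierInv_dilate_translate (fun x => (φ x : ℂ)) hp k x
  rw [Real.fourierInv_eq', hψ] at this
  simp only [smul_eq_mul, mul_left_comm _ (dftCoeff f h n k)] at this ⊢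
  rw [integral_const_mul, this]
  push_cast
  ring

/-! ### Admissible weights and amalgam norms -/

/-- The Cauchy-Schwarz inequality for series in `[0, ∞]`. -/
theorem ENNReal.tsum_mul_sq_le {ι : Type*} (a b : ι → ENNReal) :
    (∑' i, a i * b i) ^ 2 ≤ (∑' i, a i ^ 2) * ∑' i, b i ^ 2 := by
  let _ : MeasurableSpace ι := ⊤
  have h := ENNReal.lintegral_mul_le_Lp_mul_Lq (Measure.count : Measure ι)
    Real.HolderConjugate.two_two (f := a) (g := b) (by fun_prop) (by fun_prop)
  simp only [lintegral_count, Pi.mul_apply, ENNReal.rpow_two] at h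
  calc _ ≤ ((∑' i, a i ^ 2) ^ (1 / (2 : ℝ)) * (∑' i, b i ^ 2) ^ (1 / (2 : ℝ))) ^ 2 := by gcongr
    _ = _ := by
      rw [mul_pow, ← ENNReal.rpow_two, ← ENNReal.rpow_two, ← ENNReal.rpow_mul, ← ENNReal.rpow_mul]
      norm_num

namespace IsAdmissibleWeight

variable {v : ℝ → ℝ}

theorem one_le (hv : IsAdmissibleWeight v) (x : ℝ) : 1 ≤ v x := by
  have h0 := hv.submul 0 0
  rw [add_zero] at h0
  have h1 : 1 ≤ v 0 := by
    have := hv.pos 0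
    by_contra hlt
    push Not at hlt
    nlinarith
  exact h1.trans (hv.mono 0 x (by simp))

theorem measurable (hv : IsAdmissibleWeight v) : Measurable v := by
  -- On the half-line `v` is monotone, and `v x` depends on `|x|` only.
  have hm : Monotone (fun y : ℝ => v (max y 0)) := fun a b hab => by
    refine hv.mono _ _ ?_
    rw [abs_of_nonneg (le_max_right _ _), abs_of_nonneg (le_max_right _ _)]
    exact max_le_max_right 0 hab
  have h : v = (fun y : ℝ => v (max y 0)) ∘ fun x => |x| := by
    ext x
    simp only [Function.comp_apply, max_eq_left (abs_nonneg x)]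
    exact le_antisymm (hv.mono _ _ (by simp)) (hv.mono _ _ (by simp))
  rw [h]
  exact hm.measurable.comp measurable_id.abs

theorem inv_sq_le (hv : IsAdmissibleWeight v) {x y : ℝ} (h : |x| ≤ |y|) :
    (v y ^ 2)⁻¹ ≤ (v x ^ 2)⁻¹ := by
  have := hv.pos x
  have := hv.mono x y h
  gcongr

theorem summable_tailPhi (hv : IsAdmissibleWeight v) {p : ℝ} (hp : 1 ≤ p) :
    Summable fun m : ℕ => (v (p * (m : ℝ) + p / 2) ^ 2)⁻¹ := by
  have h := hv.summable_inv_sq.comp_injective Nat.cast_injective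
  refine Summable.of_nonneg_of_le (fun m => by positivity) (fun m => ?_) h
  simp only [Function.comp_apply, Int.cast_natCast]
  refine hv.inv_sq_le ?_
  have hm : (0 : ℝ) ≤ m := m.cast_nonneg
  rw [abs_of_nonneg hm, abs_of_nonneg (by positivity)]
  nlinarith

theorem tailPhi_sq (v : ℝ → ℝ) (p : ℝ) :
    tailPhi v p ^ 2 = 2 * ∑' m : ℕ, (v (p * (m : ℝ) + p / 2) ^ 2)⁻¹ :=
  Real.sq_sqrt (mul_nonneg zero_le_two (tsum_nonneg fun m => by positivity))

theorem two_mul_inv_sq_le_tailPhi_sq (hv : IsAdmissibleWeight v) {p : ℝ} (hp : 1 ≤ p) :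
    2 * (v (p / 2) ^ 2)⁻¹ ≤ tailPhi v p ^ 2 := by
  rw [tailPhi_sq]
  have := (hv.summable_tailPhi hp).le_tsum 0 (fun m _ => by positivity)
  simpa using this

/-- For `t ∈ (-1/2, 1/2]` and `m ≠ 0` one has `|t + m| ≥ |m| - 1/2`, so each of the two half-lines
contributes at most half of `tailPhi v p ^ 2`. -/
theorem tsum_inv_sq_le (hv : IsAdmissibleWeight v) {p t : ℝ} (hp : 1 ≤ p)
    (ht : t ∈ Ioc (-(1 / 2) : ℝ) (1 / 2)) :
    ∑' m : ℤ, (if m = 0 then 0 else ENNReal.ofReal ((v (p * (t + m)) ^ 2)⁻¹))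
      ≤ ENNReal.ofReal (tailPhi v p ^ 2) := by
  have hb : ∀ (m : ℕ) (s : ℝ), (m : ℝ) + 1 / 2 ≤ |s| →
      ENNReal.ofReal ((v (p * s) ^ 2)⁻¹)
        ≤ ENNReal.ofReal ((v (p * (m : ℝ) + p / 2) ^ 2)⁻¹) := by
    intro m s hs
    refine ENNReal.ofReal_le_ofReal (hv.inv_sq_le ?_)
    have hm : (0 : ℝ) ≤ m := m.cast_nonneg
    rw [abs_of_nonneg (by positivity), abs_mul, abs_of_nonneg (by linarith : (0 : ℝ) ≤ p)]
    nlinarith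
  rw [tailPhi_sq, ENNReal.ofReal_mul zero_le_two,
    ENNReal.ofReal_tsum_of_nonneg (fun m => by positivity) (hv.summable_tailPhi hp),
    tsum_of_nat_of_neg_add_one ENNReal.summable ENNReal.summable,
    tsum_eq_zero_add' ENNReal.summable]
  simp only [ENNReal.ofReal_ofNat, two_mul, Nat.cast_zero, if_true, zero_add]
  have h1 := ht.1
  have h2 := ht.2
  gcongr with m m
  · rw [if_neg (by omega)]
    refine hb m _ ?_
    push_cast
    refine le_trans ?_ (le_abs_self _)
    linarith
  · rw [if_neg (by omega)]
    refine hb m _ ?_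
    push_cast
    refine le_trans ?_ (neg_le_abs _)
    linarith

/-- The `ℓ²` energy off the central cell is at most `tailPhi v p ^ 2` times the weighted energy. -/
theorem tsum_enorm_sq_le (hv : IsAdmissibleWeight v) {p t : ℝ} (hp : 1 ≤ p)
    (ht : t ∈ Ioc (-(1 / 2) : ℝ) (1 / 2)) (g : ℤ → ℂ) :
    ∑' m : ℤ, (if m = 0 then 0 else ‖g m‖ₑ ^ 2)
      ≤ ENNReal.ofReal (tailPhi v p ^ 2) *
        ∑' m : ℤ, (if m = 0 then 0 else ‖g m‖ₑ ^ 2 * ENNReal.ofReal (v (p * (t + m)) ^ 2)) := by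
  rw [← ENNReal.tsum_mul_left]
  refine ENNReal.tsum_le_tsum fun m => ?_
  split_ifs with hm
  · simp
  have h1 : ENNReal.ofReal ((v (p * (t + m)) ^ 2)⁻¹) ≤ ENNReal.ofReal (tailPhi v p ^ 2) := by
    have := (ENNReal.le_tsum m).trans (hv.tsum_inv_sq_le hp ht)
    simpa only [if_neg hm] using this
  have hpos := hv.pos (p * (t + m))
  calc ‖g m‖ₑ ^ 2 = ENNReal.ofReal ((v (p * (t + m)) ^ 2)⁻¹) *
        (‖g m‖ₑ ^ 2 * ENNReal.ofReal (v (p * (t + m)) ^ 2)) := by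
        rw [mul_left_comm, ← ENNReal.ofReal_mul (by positivity), inv_mul_cancel₀ (by positivity)]
        simp
    _ ≤ _ := by gcongr

/-- The periodization tail off the central cell, bounded by Cauchy-Schwarz against the weight. -/
theorem enorm_tsum_sq_le (hv : IsAdmissibleWeight v) {p t : ℝ} (hp : 1 ≤ p)
    (ht : t ∈ Ioc (-(1 / 2) : ℝ) (1 / 2)) (g : ℤ → ℂ) :
    ‖∑' m : ℤ, (if m = 0 then 0 else g m)‖ₑ ^ 2
      ≤ ENNReal.ofReal (tailPhi v p ^ 2) *
        ∑' m : ℤ, (if m = 0 then 0 else ‖g m‖ₑ ^ 2 * ENNReal.ofReal (v (p * (t + m)) ^ 2)) := by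
  set a : ℤ → ENNReal := fun m => if m = 0 then 0 else ENNReal.ofReal (v (p * (t + m)))⁻¹ with ha
  set b : ℤ → ENNReal := fun m => if m = 0 then 0 else ‖g m‖ₑ * ENNReal.ofReal (v (p * (t + m)))
    with hb
  have h1 : ‖∑' m : ℤ, (if m = 0 then 0 else g m)‖ₑ ≤ ∑' m, a m * b m := by
    refine enorm_tsum_le_tsum_enorm.trans (ENNReal.tsum_le_tsum fun m => ?_)
    simp only [ha, hb]
    split_ifs with hm
    · simp
    · have hpos := hv.pos (p * (t + m))
      rw [mul_left_comm, ← ENNReal.ofReal_mul (by positivity), inv_mul_cancel₀ (by positivity)]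
      simp
  calc _ ≤ (∑' m, a m * b m) ^ 2 := by gcongr
    _ ≤ (∑' m, a m ^ 2) * ∑' m, b m ^ 2 := ENNReal.tsum_mul_sq_le a b
    _ ≤ _ := by
      gcongr with m
      · refine le_trans (le_of_eq (tsum_congr fun m => ?_)) (hv.tsum_inv_sq_le hp ht)
        simp only [ha]
        split_ifs with hm
        · simp
        · have hpos := hv.pos (p * (t + m))
          rw [← ENNReal.ofReal_pow (by positivity), inv_pow]
      · simp only [hb]
        split_ifs with hm
        · simp
        · have hpos := hv.pos (p * (t + m))
          rw [mul_pow, ← ENNReal.ofReal_pow (by positivity)]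

end IsAdmissibleWeight

theorem localSup_nonneg (f : ℝ → ℂ) (l : ℤ) : 0 ≤ localSup f l :=
  Real.iSup_nonneg fun _ => norm_nonneg _

theorem norm_le_localSup {f : ℝ → ℂ} (hf : Continuous f) {x : ℝ} (hx : x ∈ Icc (0 : ℝ) 1) (l : ℤ) :
    ‖f (x + l)‖ ≤ localSup f l := by
  have : BddAbove (range fun x : Icc (0 : ℝ) 1 => ‖f ((x : ℝ) + (l : ℝ))‖) :=
    (isCompact_range (by fun_prop)).bddAbove
  exact le_ciSup this ⟨x, hx⟩

theorem norm_le_localSup_floor {f : ℝ → ℂ} (hf : Continuous f) (x : ℝ) :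
    ‖f x‖ ≤ localSup f ⌊x⌋ := by
  have := norm_le_localSup hf (x := Int.fract x) ⟨Int.fract_nonneg x, (Int.fract_lt_one x).le⟩ ⌊x⌋
  rwa [Int.fract_add_floor] at this

theorem wienerNorm_sq (v : ℝ → ℝ) (f : ℝ → ℂ) :
    wienerNorm v f ^ 2 = ∑' l : ℤ, localSup f l ^ 2 * v (l : ℝ) ^ 2 :=
  Real.sq_sqrt (tsum_nonneg fun l => by positivity)

theorem MemWiener.tsum_ofReal {v : ℝ → ℝ} {f : ℝ → ℂ} (hf : MemWiener v f) :
    ∑' l : ℤ, ENNReal.ofReal (localSup f l ^ 2 * v (l : ℝ) ^ 2)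
      = ENNReal.ofReal (wienerNorm v f ^ 2) := by
  rw [wienerNorm_sq, ENNReal.ofReal_tsum_of_nonneg (fun l => by positivity) hf.2]

theorem enorm_sq_mul_weight_le {v : ℝ → ℝ} (hv : IsAdmissibleWeight v) {f : ℝ → ℂ}
    (hf : Continuous f) {x : ℝ} (hx : x ∈ Icc (0 : ℝ) 1) (l : ℤ) :
    ‖f (x + l)‖ₑ ^ 2 * ENNReal.ofReal (v (x + l) ^ 2)
      ≤ ENNReal.ofReal (v 1 ^ 2) * ENNReal.ofReal (localSup f l ^ 2 * v (l : ℝ) ^ 2) := by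
  rw [← ofReal_norm, ← ENNReal.ofReal_pow (norm_nonneg _), ← ENNReal.ofReal_mul (by positivity),
    ← ENNReal.ofReal_mul (by positivity)]
  apply ENNReal.ofReal_le_ofReal
  have h1 := norm_le_localSup hf hx l
  have h2 : v (x + l) ≤ v 1 * v l := (hv.submul x l).trans <| by
    have := hv.pos l
    gcongr
    exact hv.mono _ _ (by rw [abs_of_nonneg hx.1, abs_one]; exact hx.2)
  have h3 := (hv.pos (x + l)).le
  calc _ ≤ localSup f l ^ 2 * (v 1 * v l) ^ 2 := by gcongr
    _ = _ := by ring

/-- Each cell `[l, l + 1)` contains at most `1 / δ + 1` points of the lattice `δℤ`. -/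
theorem tsum_floor_mul_le (G : ℤ → ENNReal) {δ : ℝ} (hδ : 0 < δ) :
    ∑' k : ℤ, G ⌊δ * k⌋ ≤ ENNReal.ofReal (1 / δ + 1) * ∑' l : ℤ, G l := by
  have h1 : ∀ k : ℤ, G ⌊δ * k⌋ = ∑' l : ℤ, if l = ⌊δ * k⌋ then G l else 0 := fun k => by
    rw [tsum_ite_eq]
  simp_rw [h1]
  rw [ENNReal.tsum_comm, ← ENNReal.tsum_mul_left]
  refine ENNReal.tsum_le_tsum fun l => ?_
  set s : Finset ℤ := Finset.Ico ⌈l / δ⌉ ⌈(l + 1) / δ⌉ with hs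
  have hmem : ∀ k : ℤ, k ∈ s ↔ l = ⌊δ * k⌋ := fun k => by
    rw [hs, Finset.mem_Ico, Int.ceil_le, Int.lt_ceil, eq_comm, Int.floor_eq_iff, div_le_iff₀ hδ,
      lt_div_iff₀ hδ, mul_comm]
  simp_rw [← hmem]
  rw [tsum_eq_sum (s := s) (fun k hk => if_neg hk), Finset.sum_ite_mem, Finset.inter_self,
    Finset.sum_const, nsmul_eq_mul]
  gcongr
  rw [← ENNReal.ofReal_natCast]
  apply ENNReal.ofReal_le_ofReal
  have hle : ⌈l / δ⌉ ≤ ⌈(l + 1) / δ⌉ := Int.ceil_le_ceil (by gcongr; linarith)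
  have hc : ((s.card : ℤ) : ℝ) = ⌈(l + 1) / δ⌉ - ⌈l / δ⌉ := by
    rw [hs, Int.card_Ico, Int.toNat_of_nonneg (by omega)]; push_cast; ring
  rw [Int.cast_natCast] at hc
  rw [hc]
  have h1 := Int.ceil_lt_add_one ((l + 1) / δ)
  have h2 := Int.le_ceil (l / δ)
  have h3 : ((l : ℝ) + 1) / δ = l / δ + 1 / δ := by ring
  linarith

theorem tsum_sample_le {v : ℝ → ℝ} (hv : IsAdmissibleWeight v) {f : ℝ → ℂ} (hf : MemWiener v f)
    {δ : ℝ} (hδ : 0 < δ) :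
    ∑' k : ℤ, ‖f (δ * k)‖ₑ ^ 2 * ENNReal.ofReal (v (δ * k) ^ 2)
      ≤ ENNReal.ofReal ((1 / δ + 1) * (v 1 ^ 2 * wienerNorm v f ^ 2)) := by
  rw [ENNReal.ofReal_mul (by positivity), ENNReal.ofReal_mul (by positivity), ← hf.tsum_ofReal,
    ← ENNReal.tsum_mul_left]
  refine le_trans (ENNReal.tsum_le_tsum fun k => ?_) (tsum_floor_mul_le _ hδ)
  have := enorm_sq_mul_weight_le hv hf.1 (x := Int.fract (δ * k))
    ⟨Int.fract_nonneg _, (Int.fract_lt_one _).le⟩ ⌊δ * k⌋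
  rwa [Int.fract_add_floor] at this

theorem lintegral_eq_tsum_Ioc (F : ℝ → ENNReal) (a : ℝ) :
    ∫⁻ x, F x = ∑' m : ℤ, ∫⁻ x in Ioc a (a + 1), F (x + m) := by
  rw [← setLIntegral_univ, ← iUnion_Ioc_add_intCast a,
    lintegral_iUnion (fun m => measurableSet_Ioc) (pairwise_disjoint_Ioc_add_intCast a)]
  refine tsum_congr fun m => ?_
  have := (measurePreserving_add_right (volume : Measure ℝ) (m : ℝ)).setLIntegral_comp_emb
    (measurableEmbedding_addRight _) F (Ioc a (a + 1))
  rw [this]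
  simp [add_right_comm]

theorem lintegral_enorm_sq_mul_weight_le {v : ℝ → ℝ} (hv : IsAdmissibleWeight v) {f : ℝ → ℂ}
    (hf : MemWiener v f) :
    ∫⁻ x, ‖f x‖ₑ ^ 2 * ENNReal.ofReal (v x ^ 2)
      ≤ ENNReal.ofReal (v 1 ^ 2 * wienerNorm v f ^ 2) := by
  rw [lintegral_eq_tsum_Ioc _ 0, ENNReal.ofReal_mul (by positivity), ← hf.tsum_ofReal,
    ← ENNReal.tsum_mul_left]
  refine ENNReal.tsum_le_tsum fun l => ?_
  calc _ ≤ ∫⁻ _ in Ioc (0 : ℝ) (0 + 1),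
        ENNReal.ofReal (v 1 ^ 2) * ENNReal.ofReal (localSup f l ^ 2 * v (l : ℝ) ^ 2) := by
        refine setLIntegral_mono measurable_const fun x hx => ?_
        exact enorm_sq_mul_weight_le hv hf.1 ⟨hx.1.le, by linarith [hx.2]⟩ l
    _ = _ := by simp

theorem MemWiener.memLp_two {v : ℝ → ℝ} (hv : IsAdmissibleWeight v) {f : ℝ → ℂ}
    (hf : MemWiener v f) : MemLp f 2 := by
  refine ⟨hf.1.aestronglyMeasurable, ?_⟩
  rw [eLpNorm_lt_top_iff_lintegral_rpow_enorm_lt_top (by norm_num) (by norm_num)]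
  refine lt_of_le_of_lt (lintegral_mono fun x => ?_)
    ((lintegral_enorm_sq_mul_weight_le hv hf).trans_lt ENNReal.ofReal_lt_top)
  simp only [ENNReal.toReal_ofNat, ENNReal.rpow_two]
  refine le_mul_of_one_le_right (by positivity) ?_
  rw [ENNReal.one_le_ofReal]
  exact one_le_pow₀ (hv.one_le x)

theorem MemWiener.summable_localSup {v : ℝ → ℝ} (hv : IsAdmissibleWeight v) {f : ℝ → ℂ}
    (hf : MemWiener v f) : Summable (localSup f) := by
  refine Summable.of_nonneg_of_le (localSup_nonneg f) (fun l => ?_) (hf.2.add hv.summable_inv_sq)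
  have hpos := hv.pos l
  have h1 : localSup f l = (localSup f l * v l) * (v l)⁻¹ := by field_simp
  have h2 : (v (l : ℝ) ^ 2)⁻¹ = (v l)⁻¹ ^ 2 := by rw [inv_pow]
  rw [h2, ← mul_pow]
  nlinarith [sq_nonneg (localSup f l * v l - (v l)⁻¹), sq_nonneg (localSup f l * v l + (v l)⁻¹)]

/-- Translates of a dilate of `f` are summable uniformly on compact sets, as Poisson summation
requires: on a bounded set only finitely many shifts `r` of the cell of `δ * n` are met. -/
theorem MemWiener.summable_restrict {v : ℝ → ℝ} (hv : IsAdmissibleWeight v) {f : ℝ → ℂ}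
    (hf : MemWiener v f) {δ : ℝ} (hδ : 0 < δ) (u : C(ℝ, ℂ)) (hu : ∀ x, u x = f (δ * x))
    (K : TopologicalSpace.Compacts ℝ) :
    Summable fun n : ℤ => ‖(u.comp (ContinuousMap.addRight (n : ℝ))).restrict K‖ := by
  obtain ⟨R, hR⟩ := K.isCompact.isBounded.exists_norm_le
  obtain ⟨N, hN⟩ := exists_nat_ge (δ * R + 1)
  have hsum : ∀ r : ℤ, Summable fun n : ℤ => localSup f (⌊δ * n⌋ + r) := by
    intro r
    have hS : Summable fun l : ℤ => localSup f (l + r) :=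
      (hf.summable_localSup hv).comp_injective (add_left_injective r)
    have h1 := tsum_floor_mul_le (fun l => ENNReal.ofReal (localSup f (l + r))) hδ
    rw [← ENNReal.ofReal_tsum_of_nonneg (fun l => localSup_nonneg f _) hS,
      ← ENNReal.ofReal_mul (by positivity)] at h1
    have h2 := ENNReal.summable_toReal (h1.trans_lt ENNReal.ofReal_lt_top).ne
    refine h2.congr fun n => ?_
    rw [ENNReal.toReal_ofReal (localSup_nonneg f _)]
  refine Summable.of_nonneg_of_le (fun n => norm_nonneg _) (fun n => ?_)
    (summable_sum (s := Finset.Icc (-(N : ℤ)) N) fun r _ => hsum r)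
  refine (ContinuousMap.norm_le _ (Finset.sum_nonneg fun r _ => localSup_nonneg f _)).2 ?_
  rintro ⟨x, hx⟩
  have hxR := abs_le.1 (hR x hx)
  simp only [ContinuousMap.restrict_apply, ContinuousMap.comp_apply, ContinuousMap.coe_addRight,
    hu]
  refine (norm_le_localSup_floor hf.1 _).trans ?_
  have e : ⌊δ * (x + n)⌋ = ⌊δ * n⌋ + (⌊δ * (x + n)⌋ - ⌊δ * n⌋) := by ring
  rw [e]
  refine Finset.single_le_sum (f := fun r => localSup f (⌊δ * n⌋ + r))
    (fun r _ => localSup_nonneg f _) ?_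
  have a1 := Int.floor_le (δ * (x + n))
  have a2 := Int.lt_floor_add_one (δ * (x + n))
  have a3 := Int.floor_le (δ * n)
  have a4 := Int.lt_floor_add_one (δ * n)
  have b1 : δ * x ≤ δ * R := by nlinarith
  have b2 : -(δ * R) ≤ δ * x := by nlinarith
  rw [Finset.mem_Icc]
  constructor
  · rw [← Int.cast_le (R := ℝ)]; push_cast; linarith
  · rw [← Int.cast_le (R := ℝ)]; push_cast; linarith

theorem MemWiener.integrable {v : ℝ → ℝ} (hv : IsAdmissibleWeight v) {f : ℝ → ℂ}
    (hf : MemWiener v f) : Integrable f :=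
  Real.integrable_of_summable_norm_Icc (f := ⟨f, hf.1⟩)
    (hf.summable_restrict hv one_pos ⟨f, hf.1⟩ (fun x => by simp) ⟨Icc 0 1, isCompact_Icc⟩)

theorem MemWiener.summable_comp_mul {v : ℝ → ℝ} (hv : IsAdmissibleWeight v) {f : ℝ → ℂ}
    (hf : MemWiener v f) {δ : ℝ} (hδ : 0 < δ) (x : ℝ) :
    Summable fun n : ℤ => f (δ * (x + n)) := by
  have hc : Continuous fun x => f (δ * x) := hf.1.comp (by fun_prop)
  have h := hf.summable_restrict hv hδ ⟨_, hc⟩ (fun _ => rfl) ⟨{x}, isCompact_singleton⟩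
  refine Summable.of_norm_bounded h fun n => ?_
  exact ContinuousMap.norm_coe_le_norm ((ContinuousMap.comp ⟨_, hc⟩
    (ContinuousMap.addRight (n : ℝ))).restrict {x}) ⟨x, rfl⟩

/-! ### The periodization estimate -/

theorem enorm_add_sq_le {E : Type*} [SeminormedAddCommGroup E] (a b : E) :
    ‖a + b‖ₑ ^ 2 ≤ 2 * ‖a‖ₑ ^ 2 + 2 * ‖b‖ₑ ^ 2 := by
  simp only [← ofReal_norm]
  rw [← ENNReal.ofReal_pow (norm_nonneg _), ← ENNReal.ofReal_pow (norm_nonneg _),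
    ← ENNReal.ofReal_pow (norm_nonneg _), ← ENNReal.ofReal_ofNat 2,
    ← ENNReal.ofReal_mul zero_le_two, ← ENNReal.ofReal_mul zero_le_two,
    ← ENNReal.ofReal_add (by positivity) (by positivity)]
  apply ENNReal.ofReal_le_ofReal
  have := norm_add_le a b
  nlinarith [sq_nonneg (‖a‖ - ‖b‖), norm_nonneg (a + b), norm_nonneg a, norm_nonneg b]

theorem enorm_sub_sq_le {E : Type*} [SeminormedAddCommGroup E] (a b : E) :
    ‖a - b‖ₑ ^ 2 ≤ 2 * ‖a‖ₑ ^ 2 + 2 * ‖b‖ₑ ^ 2 := by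
  simpa [sub_eq_add_neg] using enorm_add_sq_le a (-b)

/-- `ψ` behaves like the indicator of `(-1/2, 1/2]` up to an error which the weight `v` absorbs:
on that cell `ψ` is close to one, its translates by nonzero integers are small in `ℓ²`, the
defect at scale `p` being at most `K * tailPhi v p ^ 2 * v (p * t) ^ 2`; moreover the `ℓ²`
periodization of `ψ` is bounded by `K`. -/
structure IsPeriodizationKernel (v ψ : ℝ → ℝ) (K : ℝ) : Prop where
  measurable : Measurable ψ
  nonneg : 0 ≤ K
  deviation_le : ∀ p : ℝ, 1 ≤ p → ∀ t ∈ Ioc (-(1 / 2) : ℝ) (1 / 2),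
    ‖1 - ψ t‖ₑ ^ 2 + ∑' m : ℤ, (if m = 0 then 0 else ‖ψ (t + m)‖ₑ ^ 2)
      ≤ ENNReal.ofReal K * ENNReal.ofReal (tailPhi v p ^ 2) * ENNReal.ofReal (v (p * t) ^ 2)
  tsum_le : ∀ t ∈ Ioc (-(1 / 2) : ℝ) (1 / 2), ∑' m : ℤ, ‖ψ (t + m)‖ₑ ^ 2 ≤ ENNReal.ofReal K

/-- The pointwise estimate behind the `L²` bound. With `R` the periodization tail of `u` and `Q` the
difference between the periodization and `T`, one has `T = u t + R - Q`. -/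
theorem IsPeriodizationKernel.tsum_enorm_sub_sq_le {v ψ : ℝ → ℝ} {K : ℝ}
    (hψ : IsPeriodizationKernel v ψ K) (hv : IsAdmissibleWeight v) {p t : ℝ} (hp : 1 ≤ p)
    (ht : t ∈ Ioc (-(1 / 2) : ℝ) (1 / 2)) {u : ℝ → ℂ} (hu : Summable fun m : ℤ => u (t + m))
    (T : ℂ) :
    ∑' m : ℤ, ‖u (t + m) - ψ (t + m) * T‖ₑ ^ 2
      ≤ ENNReal.ofReal (4 * (1 + K) * tailPhi v p ^ 2) *
          (∑' m : ℤ, ‖u (t + m)‖ₑ ^ 2 * ENNReal.ofReal (v (p * (t + m)) ^ 2))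
        + ENNReal.ofReal (4 * K) * ‖(∑' m : ℤ, u (t + m)) - T‖ₑ ^ 2 := by
  set R : ℂ := ∑' m : ℤ, (if m = 0 then 0 else u (t + m)) with hR
  set Q : ℂ := (∑' m : ℤ, u (t + m)) - T with hQ
  have hT : T = u t + R - Q := by
    have := hu.tsum_eq_add_tsum_ite 0
    rw [hQ, this, hR]; simp
  set Φ := ENNReal.ofReal (tailPhi v p ^ 2) with hΦ
  set k := ENNReal.ofReal K with hk
  set W' := ∑' m : ℤ, (if m = 0 then 0 else
    ‖u (t + m)‖ₑ ^ 2 * ENNReal.ofReal (v (p * (t + m)) ^ 2)) with hW'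
  have hR2 : ‖R‖ₑ ^ 2 ≤ Φ * W' := hv.enorm_tsum_sq_le hp ht fun m => u (t + m)
  have hU2 : ∑' m : ℤ, (if m = 0 then 0 else ‖u (t + m)‖ₑ ^ 2) ≤ Φ * W' :=
    hv.tsum_enorm_sq_le hp ht fun m => u (t + m)
  have hW : ∑' m : ℤ, ‖u (t + m)‖ₑ ^ 2 * ENNReal.ofReal (v (p * (t + m)) ^ 2)
      = ‖u t‖ₑ ^ 2 * ENNReal.ofReal (v (p * t) ^ 2) + W' := by
    rw [ENNReal.tsum_eq_add_tsum_ite 0, Int.cast_zero, add_zero, hW']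
    congr!
  have hRQ : ‖Q - R‖ₑ ^ 2 ≤ 2 * ‖Q‖ₑ ^ 2 + 2 * (Φ * W') :=
    (enorm_sub_sq_le Q R).trans (by gcongr)
  have hterm : ∀ m : ℤ, ‖u (t + m) - ψ (t + m) * T‖ₑ ^ 2 ≤
      4 * (if m = 0 then 0 else ‖u (t + m)‖ₑ ^ 2)
      + 4 * ((if m = 0 then ‖1 - ψ t‖ₑ ^ 2 else 0)
          + (if m = 0 then 0 else ‖ψ (t + m)‖ₑ ^ 2)) * ‖u t‖ₑ ^ 2
      + 2 * ‖ψ (t + m)‖ₑ ^ 2 * ‖Q - R‖ₑ ^ 2 := by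
    intro m
    have e : u (t + m) - ψ (t + m) * T
        = (u (t + m) - ψ (t + m) * u t) + ψ (t + m) * (Q - R) := by rw [hT]; ring
    rw [e]
    -- For `m = 0` the first bracket is `(1 - ψ t) * u t`, which is small although `u t` is not.
    refine (enorm_add_sq_le _ _).trans ?_
    have e2 : ‖(ψ (t + m) : ℂ) * (Q - R)‖ₑ ^ 2 = ‖ψ (t + m)‖ₑ ^ 2 * ‖Q - R‖ₑ ^ 2 := by
      rw [enorm_mul, mul_pow, ← ofReal_norm, Complex.norm_real, ofReal_norm]
    rw [e2, ← mul_assoc]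
    gcongr
    split_ifs with hm
    · subst hm
      have e3 : u (t + (0 : ℤ)) - ψ (t + (0 : ℤ)) * u t = ((1 - ψ t : ℝ) : ℂ) * u t := by
        push_cast; rw [add_zero]; ring
      rw [e3, enorm_mul, mul_pow, ← ofReal_norm, Complex.norm_real, ofReal_norm, mul_zero, zero_add,
        add_zero, ← mul_assoc]
      gcongr
      norm_num
    · refine le_trans (mul_le_mul_right (enorm_sub_sq_le _ _) 2) (le_of_eq ?_)
      rw [enorm_mul, mul_pow, ← ofReal_norm (ψ (t + m) : ℂ), Complex.norm_real, ofReal_norm]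
      ring
  have hdev := hψ.deviation_le p hp t ht
  have hsum := hψ.tsum_le t ht
  have hofR : ENNReal.ofReal (4 * (1 + K) * tailPhi v p ^ 2) = 4 * (1 + k) * Φ := by
    rw [ENNReal.ofReal_mul (by have := hψ.nonneg; positivity), ENNReal.ofReal_mul (by norm_num),
      ENNReal.ofReal_add zero_le_one hψ.nonneg]
    simp [hk, hΦ]
  have hofR2 : ENNReal.ofReal (4 * K) = 4 * k := by
    rw [ENNReal.ofReal_mul (by norm_num)]; simp [hk]
  rw [hofR, hofR2, hW]
  refine (ENNReal.tsum_le_tsum hterm).trans ?_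
  rw [ENNReal.tsum_add, ENNReal.tsum_add, ENNReal.tsum_mul_left, ENNReal.tsum_mul_right,
    ENNReal.tsum_mul_right, ENNReal.tsum_mul_left, ENNReal.tsum_mul_left, ENNReal.tsum_add,
    tsum_ite_eq]
  set a := ‖u t‖ₑ ^ 2
  set b := ENNReal.ofReal (v (p * t) ^ 2)
  set q := ‖Q‖ₑ ^ 2
  calc _ ≤ 4 * (Φ * W') + 4 * (k * Φ * b) * a + 2 * k * (2 * q + 2 * (Φ * W')) := by gcongr
    _ = 4 * (1 + k) * Φ * W' + 4 * k * Φ * (a * b) + 4 * k * q := by ring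
    _ ≤ 4 * (1 + k) * Φ * W' + 4 * (1 + k) * Φ * (a * b) + 4 * k * q := by
        gcongr; exact le_add_self
    _ = _ := by ring

theorem IsPeriodizationKernel.lintegral_enorm_sub_sq_le {v ψ : ℝ → ℝ} {K : ℝ}
    (hψ : IsPeriodizationKernel v ψ K) (hv : IsAdmissibleWeight v) {p : ℝ} (hp : 1 ≤ p)
    {u T : ℝ → ℂ} (hum : Measurable u) (hu : ∀ t, Summable fun m : ℤ => u (t + m))
    (hTm : Measurable T) (hT : ∀ (t : ℝ) (m : ℤ), T (t + m) = T t) :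
    ∫⁻ t, ‖u t - ψ t * T t‖ₑ ^ 2
      ≤ ENNReal.ofReal (4 * (1 + K) * tailPhi v p ^ 2) *
          (∫⁻ t, ‖u t‖ₑ ^ 2 * ENNReal.ofReal (v (p * t) ^ 2))
        + ENNReal.ofReal (4 * K) * ∫⁻ t in Ioc (-(1 / 2) : ℝ) (-(1 / 2) + 1),
            ‖(∑' m : ℤ, u (t + m)) - T t‖ₑ ^ 2 := by
  have hψm := hψ.measurable
  have hvm := hv.measurable
  rw [lintegral_eq_tsum_Ioc _ (-(1 / 2)),
    lintegral_eq_tsum_Ioc (fun t => ‖u t‖ₑ ^ 2 * _) (-(1 / 2)),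
    ← lintegral_tsum (fun m => by fun_prop), ← lintegral_tsum (fun m => by fun_prop),
    ← lintegral_const_mul' _ _ ENNReal.ofReal_ne_top,
    ← lintegral_const_mul' _ _ ENNReal.ofReal_ne_top, ← lintegral_add_left (by fun_prop)]
  refine setLIntegral_mono' measurableSet_Ioc fun t ht => ?_
  simp only [hT]
  exact hψ.tsum_enorm_sub_sq_le hv hp (by convert ht using 2; norm_num) (hu t) (T t)

/-- **Parseval's identity** for the difference of a periodization and a trigonometric polynomial:
the Fourier coefficients of the periodization are the values of `𝓕 u` at the integers. -/
theorem lintegral_periodization_sub_trigPoly (u : C(ℝ, ℂ))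
    (hu : ∀ K : TopologicalSpace.Compacts ℝ,
      Summable fun n : ℤ => ‖(u.comp (ContinuousMap.addRight (n : ℝ))).restrict K‖)
    (s : Finset ℤ) (a : ℤ → ℂ) (r : ℝ) :
    ∫⁻ t in Ioc r (r + 1), ‖(∑' m : ℤ, u (t + m)) -
        ∑ k ∈ s, a k * Complex.exp (2 * Real.pi * Complex.I * ((k : ℂ) * (t : ℂ)))‖ₑ ^ 2
      = ∑' k : ℤ, ‖𝓕 (u : ℝ → ℂ) k - if k ∈ s then a k else 0‖ₑ ^ 2 := by
  classical
  let F : C(UnitAddCircle, ℂ) :=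
    ⟨(u.periodic_tsum_comp_add_zsmul 1).lift, continuous_coinduced_dom.mpr (map_continuous _)⟩
  let P : C(UnitAddCircle, ℂ) := ∑ k ∈ s, a k • fourier k
  have hF : ∀ t : ℝ, F (t : UnitAddCircle) = ∑' m : ℤ, u (t + m) := by
    intro t
    have := (ContinuousMap.hasSum_apply
      (ContinuousMap.summable_of_locally_summable_norm hu).hasSum t).tsum_eq
    simpa [F, zsmul_one] using this.symm
  have hP : ∀ t : ℝ, P (t : UnitAddCircle)
      = ∑ k ∈ s, a k * Complex.exp (2 * Real.pi * Complex.I * ((k : ℂ) * (t : ℂ))) := by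
    intro t
    simp only [P, ContinuousMap.sum_apply, ContinuousMap.smul_apply, fourier_coe_apply,
      smul_eq_mul, Complex.ofReal_one, div_one, mul_assoc]
  have hcF : ∀ k : ℤ, fourierCoeff F k = 𝓕 (u : ℝ → ℂ) k :=
    fun k => Real.fourierCoeff_tsum_comp_add hu k
  have hint : ∀ g : C(UnitAddCircle, ℂ), Integrable g AddCircle.haarAddCircle := fun g =>
    g.continuous.integrable_of_hasCompactSupport (HasCompactSupport.of_compactSpace _)
  have hcf : ∀ j k : ℤ, fourierCoeff (T := 1) (fourier j) k = if k = j then 1 else 0 := by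
    intro j k
    have h1 := (orthonormal_iff_ite.1 (orthonormal_fourier (T := 1))) k j
    rw [ContinuousMap.inner_toLp] at h1
    rw [← h1]
    simp only [fourierCoeff, smul_eq_mul, fourier_neg]
    exact integral_congr_ae (Filter.Eventually.of_forall fun x => mul_comm _ _)
  have hcP : ∀ k : ℤ, fourierCoeff P k = if k ∈ s then a k else 0 := by
    intro k
    have e : (P : UnitAddCircle → ℂ) = ∑ j ∈ s, (a j • (fourier j : UnitAddCircle → ℂ)) := by
      ext x; simp [P]
    rw [e, fourierCoeff.sum s _ fun j _ => (hint (fourier j)).smul (a j), Finset.sum_apply]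
    simp only [fourierCoeff.const_smul, hcf, smul_eq_mul, mul_ite, mul_one, mul_zero]
    rw [Finset.sum_ite_eq]
  have hcS : ∀ k : ℤ, fourierCoeff (F - P : C(UnitAddCircle, ℂ)) k
      = 𝓕 (u : ℝ → ℂ) k - if k ∈ s then a k else 0 := by
    intro k
    rw [← hcF, ← hcP]
    simp only [fourierCoeff, ContinuousMap.coe_sub, Pi.sub_apply, smul_sub]
    exact integral_sub ((hint F).fourier_smul _) ((hint P).fourier_smul _)
  have hae := ContinuousMap.coeFn_toLp (p := 2) (𝕜 := ℂ) (AddCircle.haarAddCircle (T := 1)) (F - P)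
  have hpar := hasSum_sq_fourierCoeff (ContinuousMap.toLp 2 AddCircle.haarAddCircle ℂ (F - P))
  rw [fourierCoeff_congr_ae hae] at hpar
  simp only [hcS] at hpar
  have hae2 : ∫ t : UnitAddCircle,
      ‖ContinuousMap.toLp (E := ℂ) 2 AddCircle.haarAddCircle ℂ (F - P) t‖ ^ 2
      ∂AddCircle.haarAddCircle = ∫ t : UnitAddCircle, ‖(F - P) t‖ ^ 2 ∂AddCircle.haarAddCircle := by
    refine integral_congr_ae ?_
    filter_upwards [hae] with x hx
    rw [hx]
  rw [hae2] at hpar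
  have hR : ∑' k : ℤ, ‖𝓕 (u : ℝ → ℂ) k - if k ∈ s then a k else 0‖ₑ ^ 2
      = ENNReal.ofReal (∫ t : UnitAddCircle, ‖(F - P) t‖ ^ 2 ∂AddCircle.haarAddCircle) := by
    rw [← hpar.tsum_eq, ENNReal.ofReal_tsum_of_nonneg (fun k => by positivity) hpar.summable]
    refine tsum_congr fun k => ?_
    rw [ENNReal.ofReal_pow (norm_nonneg _), ofReal_norm]
  have hvol : (volume : Measure UnitAddCircle) = AddCircle.haarAddCircle := by
    rw [AddCircle.volume_eq_smul_haarAddCircle]; simp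
  rw [hR, ofReal_integral_eq_lintegral_ofReal, ← hvol, ← UnitAddCircle.lintegral_preimage r]
  · refine lintegral_congr fun t => ?_
    rw [ContinuousMap.sub_apply, hF, hP, ENNReal.ofReal_pow (norm_nonneg _), ofReal_norm]
  · have hc : Continuous fun t : UnitAddCircle => ‖(F - P) t‖ ^ 2 := by fun_prop
    exact hc.integrable_of_hasCompactSupport (HasCompactSupport.of_compactSpace _)
  · exact Filter.Eventually.of_forall fun t => by positivity

/-! ### The index set as a system of residues -/

theorem mem_symIndex_iff (n : ℕ) (j : ℤ) : j ∈ symIndex n ↔ -(n : ℤ) < 2 * j ∧ 2 * j ≤ n := by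
  simp only [symIndex, Finset.mem_filter, Finset.mem_Icc]
  omega

theorem div_mem_Ioc_of_mem_symIndex {n : ℕ} (hn : 0 < n) {j : ℤ} (hj : j ∈ symIndex n) :
    (j : ℝ) / n ∈ Ioc (-(1 / 2) : ℝ) (1 / 2) := by
  have hn' : (0 : ℝ) < n := by exact_mod_cast hn
  obtain ⟨h1, h2⟩ := (mem_symIndex n j).1 hj
  constructor
  · rw [lt_div_iff₀ hn']; linarith
  · rw [div_le_iff₀ hn']; linarith

theorem eq_zero_of_add_mul_mem_symIndex {n : ℕ} {j m : ℤ} (hj : j ∈ symIndex n)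
    (hjm : j + n * m ∈ symIndex n) : m = 0 := by
  rw [mem_symIndex_iff] at hj hjm
  by_contra hm
  rcases lt_or_gt_of_ne hm with h | h
  · nlinarith
  · nlinarith

theorem exists_mem_symIndex {n : ℕ} (hn : 0 < n) (N : ℤ) :
    ∃ j ∈ symIndex n, ∃ m : ℤ, j + n * m = N := by
  have h1 := Int.emod_nonneg N (b := n) (by omega)
  have h2 := Int.emod_lt_of_pos N (b := n) (by omega)
  have h3 := Int.emod_add_mul_ediv N n
  by_cases h : 2 * (N % n) ≤ n
  · exact ⟨N % n, (mem_symIndex_iff n _).2 ⟨by omega, h⟩, N / n, h3⟩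
  · refine ⟨N % n - n, (mem_symIndex_iff n _).2 ⟨by omega, by omega⟩, N / n + 1, ?_⟩
    linarith

theorem bijective_symIndex_add_mul {n : ℕ} (hn : 0 < n) :
    Function.Bijective fun q : symIndex n × ℤ => (q.1 : ℤ) + n * q.2 := by
  constructor
  · rintro ⟨⟨j, hj⟩, m⟩ ⟨⟨j', hj'⟩, m'⟩ h
    simp only at h
    have h0 : m' - m = 0 := eq_zero_of_add_mul_mem_symIndex hj' (m := m' - m) (by
      rwa [show j' + n * (m' - m) = j by linarith])
    have h1 : m' = m := by linarith
    subst h1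
    simp only [Prod.mk.injEq, Subtype.mk.injEq, and_true]
    linarith
  · intro N
    obtain ⟨j, hj, m, h⟩ := exists_mem_symIndex hn N
    exact ⟨(⟨j, hj⟩, m), h⟩

theorem Summable.tsum_int_eq_sum_symIndex {a : ℤ → ℂ} (ha : Summable a) {n : ℕ} (hn : 0 < n) :
    ∑' N : ℤ, a N = ∑ j ∈ symIndex n, ∑' m : ℤ, a (j + n * m) := by
  let e := Equiv.ofBijective _ (bijective_symIndex_add_mul hn)
  have hs : Summable fun q => a (e q) := e.summable_iff.2 ha
  rw [← e.tsum_eq, hs.tsum_prod, tsum_fintype]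
  exact Finset.sum_coe_sort (symIndex n) fun j => ∑' m : ℤ, a (j + n * m)

theorem ENNReal.tsum_int_eq_sum_symIndex (a : ℤ → ENNReal) {n : ℕ} (hn : 0 < n) :
    ∑' N : ℤ, a N = ∑ j ∈ symIndex n, ∑' m : ℤ, a (j + n * m) := by
  let e := Equiv.ofBijective _ (bijective_symIndex_add_mul hn)
  rw [← e.tsum_eq, ENNReal.tsum_prod', tsum_fintype]
  exact Finset.sum_coe_sort (symIndex n) fun j => ∑' m : ℤ, a (j + n * m)

/-! ### The discrete Fourier transform on the index set -/

theorem sum_symIndex_exp {n : ℕ} (hn : 0 < n) (d : ℤ) :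
    ∑ k ∈ symIndex n, Complex.exp (2 * Real.pi * Complex.I * ((k * d : ℤ) : ℂ) / n)
      = if (n : ℤ) ∣ d then (n : ℂ) else 0 := by
  have : NeZero n := ⟨hn.ne'⟩
  have h := AddChar.sum_mulShift (d : ZMod n) (ZMod.isPrimitive_stdAddChar n)
  rw [ZMod.card] at h
  simp only [← ZMod.intCast_zmod_eq_zero_iff_dvd]
  rw [show (if (d : ZMod n) = 0 then (n : ℂ) else 0) = ((if (d : ZMod n) = 0 then n else 0 : ℕ) : ℂ)
    by split_ifs <;> simp, ← h]
  refine Finset.sum_bij (fun k _ => (k : ZMod n)) (fun _ _ => Finset.mem_univ _) ?_ ?_ ?_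
  · intro j hj j' hj' hjj
    obtain ⟨m, hm⟩ := (ZMod.intCast_eq_intCast_iff_dvd_sub j j' n).1 hjj
    have h0 := eq_zero_of_add_mul_mem_symIndex hj (m := m) (by rwa [← hm, add_sub_cancel])
    rw [h0, mul_zero] at hm
    linarith
  · intro x _
    obtain ⟨N, rfl⟩ := ZMod.intCast_surjective x
    obtain ⟨j, hj, m, hm⟩ := exists_mem_symIndex hn N
    exact ⟨j, hj, by rw [← hm]; simp⟩
  · intro k _
    rw [← Int.cast_mul, ZMod.stdAddChar_coe]

/-- **Parseval's identity** for the discrete Fourier transform on `[n]`. -/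
theorem sum_symIndex_norm_sq {n : ℕ} (hn : 0 < n) (b : ℤ → ℂ) :
    ∑ k ∈ symIndex n, ‖∑ j ∈ symIndex n, b j *
        Complex.exp (-2 * Real.pi * Complex.I * ((k : ℂ) * (j : ℂ) / (n : ℂ)))‖ ^ 2
      = n * ∑ j ∈ symIndex n, ‖b j‖ ^ 2 := by
  rw [← Complex.ofReal_inj]
  push_cast
  simp only [← Complex.mul_conj', map_sum, map_mul, Finset.sum_mul_sum]
  have hterm : ∀ k i j : ℤ,
      b i * Complex.exp (-2 * Real.pi * Complex.I * ((k : ℂ) * (i : ℂ) / (n : ℂ))) *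
        ((starRingEnd ℂ) (b j) * (starRingEnd ℂ)
          (Complex.exp (-2 * Real.pi * Complex.I * ((k : ℂ) * (j : ℂ) / (n : ℂ)))))
      = b i * (starRingEnd ℂ) (b j) *
        Complex.exp (2 * Real.pi * Complex.I * ((k * (j - i) : ℤ) : ℂ) / n) := by
    intro k i j
    rw [← Complex.exp_conj, mul_mul_mul_comm, ← Complex.exp_add]
    congr 2
    simp only [map_mul, map_div₀, Complex.conj_I, Complex.conj_ofReal, map_neg, map_ofNat,
      map_intCast, map_natCast]
    push_cast
    ring
  simp only [hterm]
  rw [Finset.sum_comm, Finset.mul_sum]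
  refine Finset.sum_congr rfl fun i hi => ?_
  rw [Finset.sum_comm, Finset.sum_eq_single_of_mem i hi]
  · rw [← Finset.mul_sum, sum_symIndex_exp hn, if_pos (by simp)]
    ring
  · intro j hj hji
    rw [← Finset.mul_sum, sum_symIndex_exp hn, if_neg, mul_zero]
    rintro ⟨m, hm⟩
    have h0 := eq_zero_of_add_mul_mem_symIndex hi (m := m) (by rwa [← hm, add_sub_cancel])
    rw [h0, mul_zero] at hm
    exact hji (by linarith)

theorem sum_symIndex_enorm_sq {n : ℕ} (hn : 0 < n) (b : ℤ → ℂ) :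
    ∑ k ∈ symIndex n, ‖∑ j ∈ symIndex n, b j *
        Complex.exp (-2 * Real.pi * Complex.I * ((k : ℂ) * (j : ℂ) / (n : ℂ)))‖ₑ ^ 2
      = n * ∑ j ∈ symIndex n, ‖b j‖ₑ ^ 2 := by
  have h := congrArg ENNReal.ofReal (sum_symIndex_norm_sq hn b)
  rw [ENNReal.ofReal_mul (by positivity), ENNReal.ofReal_sum_of_nonneg (fun _ _ => by positivity),
    ENNReal.ofReal_sum_of_nonneg (fun _ _ => by positivity), ENNReal.ofReal_natCast] at h
  simpa only [ENNReal.ofReal_pow (norm_nonneg _), ofReal_norm] using h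

/-! ### Poisson summation and aliasing -/

theorem fourier_dilate (g : ℝ → ℂ) {p : ℝ} (hp : 0 < p) (ξ : ℝ) :
    𝓕 (fun x : ℝ => g (p⁻¹ * x)) ξ = p * 𝓕 g (p * ξ) := by
  have h := fourier_dilate_modulate g hp 0 ξ
  simpa [div_eq_inv_mul] using h

section
variable {v w : ℝ → ℝ} {f : ℝ → ℂ}

theorem fourierInv_fourier_eq_of_memWiener (hv : IsAdmissibleWeight v) (hw : IsAdmissibleWeight w)
    (hf : MemWiener v f) (hf' : MemWiener w (𝓕 f)) : 𝓕⁻ (𝓕 f) = f :=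
  hf.1.fourierInv_fourier_eq (hf.integrable hv) (hf'.integrable hw)

/-- Poisson summation for `𝓕 f` along the lattice of spacing `1 / h`; the Fourier transform of `𝓕 f`
is the reflection of `f`. -/
theorem poisson_fourier (hv : IsAdmissibleWeight v) (hw : IsAdmissibleWeight w)
    (hf : MemWiener v f) (hf' : MemWiener w (𝓕 f)) {h : ℝ} (hh : 0 < h) (x : ℝ) :
    ∑' m : ℤ, 𝓕 f (h⁻¹ * (x + m))
      = h * ∑' j : ℤ, f (h * j) * Complex.exp (-2 * Real.pi * Complex.I * (x * j)) := by
  have hc : Continuous fun t : ℝ => 𝓕 f (h⁻¹ * t) := hf'.1.comp (by fun_prop)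
  have hF : ∀ j : ℤ, 𝓕 (fun t : ℝ => 𝓕 f (h⁻¹ * t)) (j : ℝ) = h * f (h * ((-j : ℤ) : ℝ)) := by
    intro j
    rw [fourier_dilate _ hh]
    have := congrFun (fourierInv_fourier_eq_of_memWiener hv hw hf hf') (h * ((-j : ℤ) : ℝ))
    rw [Real.fourierInv_eq_fourier_neg] at this
    rw [← this]
    push_cast
    ring_nf
  have hs : Summable fun j : ℤ => f (h * ((-j : ℤ) : ℝ)) := by
    have := hf.summable_comp_mul hv hh 0
    simp only [zero_add] at this
    exact (Equiv.neg ℤ).summable_iff.2 this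
  have key := Real.tsum_eq_tsum_fourier (f := ⟨_, hc⟩)
    (hf'.summable_restrict hw (inv_pos.2 hh) _ fun _ => rfl)
    (by simp only [ContinuousMap.coe_mk, hF]; exact hs.mul_left _) x
  simp only [ContinuousMap.coe_mk, hF] at key
  rw [key, ← tsum_mul_left, ← (Equiv.neg ℤ).tsum_eq]
  refine tsum_congr fun j => ?_
  rw [fourier_coe_apply, Equiv.neg_apply, neg_neg, mul_assoc]
  congr 3
  push_cast
  ring

/-- The aliasing formula: the periodization of `𝓕 f` at `k / p` is the discrete Fourier transform of
the samples of the periodization of `f`. -/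
theorem dftCoeff_add_alias (hv : IsAdmissibleWeight v) (hw : IsAdmissibleWeight w)
    (hf : MemWiener v f) (hf' : MemWiener w (𝓕 f)) {h p : ℝ} (hh : 0 < h) {n : ℕ} (hn : 0 < n)
    (hp : p = h * n) (k : ℤ) :
    ∑' m : ℤ, 𝓕 f (h⁻¹ * ((k : ℝ) / n + m))
      = dftCoeff f h n k + h * ∑ j ∈ symIndex n,
        (∑' m : ℤ, if m = 0 then 0 else f (p * ((j : ℝ) / n + m))) *
        Complex.exp (-2 * Real.pi * Complex.I * ((k : ℂ) * (j : ℂ) / (n : ℂ))) := by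
  have hn' : (n : ℝ) ≠ 0 := by exact_mod_cast hn.ne'
  have hnC : (n : ℂ) ≠ 0 := by exact_mod_cast hn.ne'
  have hp0 : 0 < p := by rw [hp]; positivity
  have hs : Summable fun j : ℤ =>
      f (h * j) * Complex.exp (-2 * Real.pi * Complex.I * (((k : ℝ) / n : ℝ) * j)) := by
    have h1 := hf.summable_comp_mul hv hh 0
    simp only [zero_add] at h1
    refine Summable.of_norm_bounded h1.norm fun j => le_of_eq ?_
    rw [norm_mul, Complex.norm_exp]
    simp
  rw [poisson_fourier hv hw hf hf' hh, hs.tsum_int_eq_sum_symIndex hn, dftCoeff, ← mul_add,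
    ← Finset.sum_add_distrib]
  congr 1
  refine Finset.sum_congr rfl fun j _ => ?_
  have hterm : ∀ m : ℤ, f (h * ((j + n * m : ℤ) : ℝ)) *
      Complex.exp (-2 * Real.pi * Complex.I * (((k : ℝ) / n : ℝ) * ((j + n * m : ℤ) : ℂ)))
      = f (p * ((j : ℝ) / n + m)) *
        Complex.exp (-2 * Real.pi * Complex.I * ((k : ℂ) * (j : ℂ) / (n : ℂ))) := by
    intro m
    have e1 : h * ((j + n * m : ℤ) : ℝ) = p * ((j : ℝ) / n + m) := by
      rw [hp]; push_cast; field_simp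
    have e2 : -2 * Real.pi * Complex.I * (((k : ℝ) / n : ℝ) * ((j + n * m : ℤ) : ℂ))
        = -2 * Real.pi * Complex.I * ((k : ℂ) * (j : ℂ) / (n : ℂ))
          + ((-(k * m) : ℤ) : ℂ) * (2 * Real.pi * Complex.I) := by
      push_cast; field_simp; ring
    rw [e1, e2, Complex.exp_add, Complex.exp_int_mul_two_pi_mul_I, mul_one]
  simp only [hterm]
  rw [tsum_mul_right, ← add_mul,
    (hf.summable_comp_mul hv hp0 ((j : ℝ) / n)).tsum_eq_add_tsum_ite 0]
  have e0 : p * ((j : ℝ) / n + (0 : ℤ)) = h * j := by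
    rw [hp, Int.cast_zero, add_zero]; field_simp
  rw [e0]

theorem tsum_tail_le_tsum_sample (w : ℝ → ℝ) (g : ℝ → ℂ) {δ : ℝ} {n : ℕ} (hn : 0 < n) :
    ∑ j ∈ symIndex n, ∑' m : ℤ, (if m = 0 then 0 else
      ‖g (δ * ((j : ℝ) / n + m))‖ₑ ^ 2 * ENNReal.ofReal (w (δ * ((j : ℝ) / n + m)) ^ 2))
    ≤ ∑' k : ℤ, ‖g (δ / n * k)‖ₑ ^ 2 * ENNReal.ofReal (w (δ / n * k) ^ 2) := by
  have hn' : (n : ℝ) ≠ 0 := by exact_mod_cast hn.ne'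
  rw [ENNReal.tsum_int_eq_sum_symIndex _ hn]
  gcongr with j hj m
  have e : δ / n * ((j + n * m : ℤ) : ℝ) = δ * ((j : ℝ) / n + m) := by
    push_cast; field_simp
  rw [e]
  split_ifs <;> simp

/-- The `ℓ²` error of the discrete Fourier transform as an approximation of `𝓕 f` on the lattice of
spacing `1 / p`. Frequencies off `[n]`, where the approximation is zero, are included. -/
theorem tsum_fourier_sub_dftCoeff_le (hv : IsAdmissibleWeight v) (hw : IsAdmissibleWeight w)
    (hf : MemWiener v f) (hf' : MemWiener w (𝓕 f)) {h p : ℝ} (hh : 0 < h) (hh1 : h ≤ 1) {n : ℕ}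
    (hp1 : 1 ≤ p) (hp : p = h * n) :
    ∑' k : ℤ, ‖𝓕 f (p⁻¹ * k) - (if k ∈ symIndex n then dftCoeff f h n k else 0)‖ₑ ^ 2
      ≤ ENNReal.ofReal (p * (4 * v 1 ^ 2 * (tailPhi v p ^ 2 * wienerNorm v f ^ 2)
          + 6 * w 1 ^ 2 * (tailPhi w h⁻¹ ^ 2 * wienerNorm w (𝓕 f) ^ 2))) := by
  have hn : 0 < n := by
    rcases Nat.eq_zero_or_pos n with h0 | h0
    · rw [h0] at hp; norm_num at hp; linarith
    · exact h0
  have hn' : (n : ℝ) ≠ 0 := by exact_mod_cast hn.ne'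
  have hinv : 1 ≤ h⁻¹ := (one_le_inv₀ hh).2 hh1
  have hp0 : 0 < p := by linarith
  have hpinv : h⁻¹ / n = p⁻¹ := by rw [hp]; field_simp
  have hhp : p / n = h := by rw [hp]; field_simp
  set X := ENNReal.ofReal (tailPhi w h⁻¹ ^ 2) with hX
  set Y := ENNReal.ofReal (tailPhi v p ^ 2) with hY
  set A : ℤ → ENNReal := fun k => ∑' m : ℤ, (if m = 0 then 0 else
      ‖𝓕 f (h⁻¹ * ((k : ℝ) / n + m))‖ₑ ^ 2 * ENNReal.ofReal (w (h⁻¹ * ((k : ℝ) / n + m)) ^ 2))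
    with hA
  set B : ℤ → ENNReal := fun j => ∑' m : ℤ, (if m = 0 then 0 else
      ‖f (p * ((j : ℝ) / n + m))‖ₑ ^ 2 * ENNReal.ofReal (v (p * ((j : ℝ) / n + m)) ^ 2)) with hB
  set b : ℤ → ℂ := fun j => ∑' m : ℤ, if m = 0 then 0 else f (p * ((j : ℝ) / n + m)) with hb
  set D : ℤ → ℂ := fun k => ∑ j ∈ symIndex n, b j *
        Complex.exp (-2 * Real.pi * Complex.I * ((k : ℂ) * (j : ℂ) / (n : ℂ))) with hD
  -- The sum over `ℤ` is split into residue classes modulo `n`; a class meets `[n]` only in `k`.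
  have hblock : ∀ k ∈ symIndex n, ∑' m : ℤ, ‖𝓕 f (p⁻¹ * ((k + n * m : ℤ) : ℝ)) -
      (if k + n * m ∈ symIndex n then dftCoeff f h n (k + n * m) else 0)‖ₑ ^ 2
      ≤ 3 * (X * A k) + 2 * (ENNReal.ofReal (h ^ 2) * ‖D k‖ₑ ^ 2) := by
    intro k hk
    have hkn := div_mem_Ioc_of_mem_symIndex hn hk
    have hterm : ∀ m : ℤ, ‖𝓕 f (p⁻¹ * ((k + n * m : ℤ) : ℝ)) -
        (if k + n * m ∈ symIndex n then dftCoeff f h n (k + n * m) else 0)‖ₑ ^ 2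
        = (if m = 0 then ‖𝓕 f (h⁻¹ * ((k : ℝ) / n)) - dftCoeff f h n k‖ₑ ^ 2 else 0)
          + (if m = 0 then 0 else ‖𝓕 f (h⁻¹ * ((k : ℝ) / n + m))‖ₑ ^ 2) := by
      intro m
      have e : p⁻¹ * ((k + n * m : ℤ) : ℝ) = h⁻¹ * ((k : ℝ) / n + m) := by
        rw [hp]; push_cast; field_simp
      rw [e]
      by_cases hm : m = 0
      · subst hm; simp [hk]
      · rw [if_neg (fun hmem => hm (eq_zero_of_add_mul_mem_symIndex hk hmem)), if_neg hm,
          if_neg hm, sub_zero, zero_add]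
    simp only [hterm]
    rw [ENNReal.tsum_add, tsum_ite_eq]
    have e1 := dftCoeff_add_alias hv hw hf hf' hh hn hp k
    rw [(hf'.summable_comp_mul hw (inv_pos.2 hh) ((k : ℝ) / n)).tsum_eq_add_tsum_ite 0] at e1
    have e2 : 𝓕 f (h⁻¹ * ((k : ℝ) / n)) - dftCoeff f h n k
        = h * D k - ∑' m : ℤ, (if m = 0 then 0 else 𝓕 f (h⁻¹ * ((k : ℝ) / n + m))) := by
      rw [Int.cast_zero, add_zero] at e1
      linear_combination e1
    have e3 := hw.enorm_tsum_sq_le hinv hkn fun m => 𝓕 f (h⁻¹ * ((k : ℝ) / n + m))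
    have e4 := hw.tsum_enorm_sq_le hinv hkn fun m => 𝓕 f (h⁻¹ * ((k : ℝ) / n + m))
    have e5 : ‖(h : ℂ) * D k‖ₑ ^ 2 = ENNReal.ofReal (h ^ 2) * ‖D k‖ₑ ^ 2 := by
      rw [enorm_mul, mul_pow, ← ofReal_norm (h : ℂ), Complex.norm_real, Real.norm_of_nonneg hh.le,
        ENNReal.ofReal_pow hh.le]
    rw [e2]
    calc _ ≤ (2 * (ENNReal.ofReal (h ^ 2) * ‖D k‖ₑ ^ 2) + 2 * (X * A k)) + X * A k := by
          refine add_le_add ((enorm_sub_sq_le _ _).trans ?_) e4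
          rw [e5]
          gcongr
      _ = _ := by ring
  have hAsum : ∑ k ∈ symIndex n, A k
      ≤ ENNReal.ofReal (2 * p * (w 1 ^ 2 * wienerNorm w (𝓕 f) ^ 2)) := by
    refine (tsum_tail_le_tsum_sample w (𝓕 f) hn).trans ?_
    rw [hpinv]
    refine (tsum_sample_le hw hf' (inv_pos.2 hp0)).trans (ENNReal.ofReal_le_ofReal ?_)
    gcongr
    rw [one_div, inv_inv]; linarith
  have hBsum : ∑ k ∈ symIndex n, B k
      ≤ ENNReal.ofReal (2 * h⁻¹ * (v 1 ^ 2 * wienerNorm v f ^ 2)) := by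
    refine (tsum_tail_le_tsum_sample v f hn).trans ?_
    rw [hhp]
    refine (tsum_sample_le hv hf hh).trans (ENNReal.ofReal_le_ofReal ?_)
    gcongr
    rw [one_div]; linarith
  have hDsum : ∑ k ∈ symIndex n, ‖D k‖ₑ ^ 2 ≤ n * (Y * ∑ k ∈ symIndex n, B k) := by
    rw [hD, sum_symIndex_enorm_sq hn, Finset.mul_sum (symIndex n) B]
    gcongr with j hj
    exact hv.enorm_tsum_sq_le hp1 (div_mem_Ioc_of_mem_symIndex hn hj)
      fun m => f (p * ((j : ℝ) / n + m))
  rw [ENNReal.tsum_int_eq_sum_symIndex _ hn]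
  refine (Finset.sum_le_sum hblock).trans ?_
  rw [Finset.sum_add_distrib, ← Finset.mul_sum, ← Finset.mul_sum, ← Finset.mul_sum,
    ← Finset.mul_sum]
  calc _ ≤ 3 * (X * ENNReal.ofReal (2 * p * (w 1 ^ 2 * wienerNorm w (𝓕 f) ^ 2)))
        + 2 * (ENNReal.ofReal (h ^ 2) * (ENNReal.ofReal n *
          (Y * ENNReal.ofReal (2 * h⁻¹ * (v 1 ^ 2 * wienerNorm v f ^ 2))))) := by
        rw [ENNReal.ofReal_natCast]
        gcongr
        exact hDsum.trans (by gcongr)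
    _ = _ := by
        rw [hX, hY, ← ENNReal.ofReal_ofNat 3, ← ENNReal.ofReal_ofNat 2,
          ← ENNReal.ofReal_mul (by positivity), ← ENNReal.ofReal_mul (by positivity),
          ← ENNReal.ofReal_mul (by positivity), ← ENNReal.ofReal_mul (by positivity),
          ← ENNReal.ofReal_mul (by positivity), ← ENNReal.ofReal_mul (by positivity),
          ← ENNReal.ofReal_add (by positivity) (by positivity)]
        congr 1
        rw [hp]
        field_simp
        ring
end

/-! ### The error bound for a general kernel -/

theorem lintegral_eq_mul_lintegral_comp_mul (F : ℝ → ENNReal) {p : ℝ} (hp : 0 < p) :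
    ∫⁻ x, F x = ENNReal.ofReal p * ∫⁻ t, F (p * t) := by
  rw [← (measurableEmbedding_mulLeft₀ hp.ne').lintegral_map F, Real.map_volume_mul_left hp.ne',
    lintegral_smul_measure, smul_eq_mul, ← mul_assoc, ← ENNReal.ofReal_mul hp.le,
    abs_of_pos (inv_pos.2 hp), mul_inv_cancel₀ hp.ne', ENNReal.ofReal_one, one_mul]

theorem dftTrigPoly_add_intCast (f : ℝ → ℂ) (h p : ℝ) (n : ℕ) (t : ℝ) (m : ℤ) :
    dftTrigPoly f h p n (t + m) = dftTrigPoly f h p n t := by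
  refine Finset.sum_congr rfl fun k _ => ?_
  have e : 2 * Real.pi * Complex.I * ((k : ℂ) * ((t + m : ℝ) : ℂ))
      = 2 * Real.pi * Complex.I * ((k : ℂ) * (t : ℂ))
        + ((k * m : ℤ) : ℂ) * (2 * Real.pi * Complex.I) := by
    push_cast; ring
  rw [e, Complex.exp_add, Complex.exp_int_mul_two_pi_mul_I, mul_one]

/-- The error bound on the side of `f`, for any kernel with a small periodization defect. -/
theorem IsPeriodizationKernel.eLpNorm_sub_le {v w ψ : ℝ → ℝ} {K : ℝ}
    (hψ : IsPeriodizationKernel v ψ K) (hv : IsAdmissibleWeight v) (hw : IsAdmissibleWeight w)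
    {f : ℝ → ℂ} (hf : MemWiener v f) (hf' : MemWiener w (𝓕 f)) {h p : ℝ} {n : ℕ}
    (hh : 0 < h) (hh1 : h ≤ 1) (hp1 : 1 ≤ p) (hp : p = h * n) :
    eLpNorm (fun x => f x - ψ (x / p) * dftTrigPoly f h p n (x / p)) 2 volume
      ≤ ENNReal.ofReal (5 * (1 + K) * (v 1 + w 1) * (tailPhi v p * wienerNorm v f
          + tailPhi w h⁻¹ * wienerNorm w (𝓕 f))) := by
  have hp0 : 0 < p := by linarith
  have hK := hψ.nonneg
  have hv1 := hv.pos 1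
  have hw1 := hw.pos 1
  have hΦv : 0 ≤ tailPhi v p := Real.sqrt_nonneg _
  have hΦw : 0 ≤ tailPhi w h⁻¹ := Real.sqrt_nonneg _
  have hNv : 0 ≤ wienerNorm v f := Real.sqrt_nonneg _
  have hNw : 0 ≤ wienerNorm w (𝓕 f) := Real.sqrt_nonneg _
  set a := tailPhi v p * wienerNorm v f with ha
  set b := tailPhi w h⁻¹ * wienerNorm w (𝓕 f) with hb
  have ha0 : 0 ≤ a := by positivity
  have hb0 : 0 ≤ b := by positivity
  let u : C(ℝ, ℂ) := ⟨fun t => f (p * t), hf.1.comp (by fun_prop)⟩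
  have hTm : Measurable (dftTrigPoly f h p n) := by
    unfold dftTrigPoly; fun_prop
  have hcore := hψ.lintegral_enorm_sub_sq_le hv hp1 (u := u) u.continuous.measurable
    (fun t => hf.summable_comp_mul hv hp0 t) hTm (dftTrigPoly_add_intCast f h p n)
  have hpars := lintegral_periodization_sub_trigPoly u
    (hf.summable_restrict hv hp0 u fun _ => rfl) (symIndex n)
    (fun k => (p : ℂ)⁻¹ * dftCoeff f h n k) (-(1 / 2))
  have hsum : ∑' k : ℤ, ‖𝓕 (u : ℝ → ℂ) k -
        (if k ∈ symIndex n then (p : ℂ)⁻¹ * dftCoeff f h n k else 0)‖ₑ ^ 2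
      ≤ ENNReal.ofReal (p⁻¹ * (4 * v 1 ^ 2 * a ^ 2 + 6 * w 1 ^ 2 * b ^ 2)) := by
    have hterm : ∀ k : ℤ, ‖𝓕 (u : ℝ → ℂ) k -
        (if k ∈ symIndex n then (p : ℂ)⁻¹ * dftCoeff f h n k else 0)‖ₑ ^ 2
        = ENNReal.ofReal (p⁻¹ ^ 2) *
          ‖𝓕 f (p⁻¹ * k) - (if k ∈ symIndex n then dftCoeff f h n k else 0)‖ₑ ^ 2 := by
      intro k
      have e1 : 𝓕 (u : ℝ → ℂ) k = (p : ℂ)⁻¹ * 𝓕 f (p⁻¹ * k) := by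
        have := fourier_dilate f (inv_pos.2 hp0) k
        rw [inv_inv, Complex.ofReal_inv] at this
        exact this
      have e2 : 𝓕 (u : ℝ → ℂ) k - (if k ∈ symIndex n then (p : ℂ)⁻¹ * dftCoeff f h n k else 0)
          = ((p⁻¹ : ℝ) : ℂ) *
            (𝓕 f (p⁻¹ * k) - (if k ∈ symIndex n then dftCoeff f h n k else 0)) := by
        rw [e1, mul_sub, mul_ite, mul_zero, Complex.ofReal_inv]
      rw [e2, enorm_mul, mul_pow, ← ofReal_norm ((p⁻¹ : ℝ) : ℂ), Complex.norm_real,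
        Real.norm_of_nonneg (inv_pos.2 hp0).le, ENNReal.ofReal_pow (inv_pos.2 hp0).le]
    simp only [hterm]
    rw [ENNReal.tsum_mul_left]
    calc _ ≤ ENNReal.ofReal (p⁻¹ ^ 2) * ENNReal.ofReal (p * (4 * v 1 ^ 2 *
          (tailPhi v p ^ 2 * wienerNorm v f ^ 2)
          + 6 * w 1 ^ 2 * (tailPhi w h⁻¹ ^ 2 * wienerNorm w (𝓕 f) ^ 2))) := by
          gcongr
          exact tsum_fourier_sub_dftCoeff_le hv hw hf hf' hh hh1 hp1 hp
      _ = _ := by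
          rw [← ENNReal.ofReal_mul (by positivity), ha, hb]
          congr 1
          field_simp
  have henergy : ∫⁻ t, ‖u t‖ₑ ^ 2 * ENNReal.ofReal (v (p * t) ^ 2)
      ≤ ENNReal.ofReal (p⁻¹ * (v 1 ^ 2 * wienerNorm v f ^ 2)) := by
    have h1 := lintegral_enorm_sq_mul_weight_le hv hf
    rw [lintegral_eq_mul_lintegral_comp_mul _ hp0] at h1
    calc ∫⁻ t, ‖u t‖ₑ ^ 2 * ENNReal.ofReal (v (p * t) ^ 2)
        = ENNReal.ofReal p⁻¹ * (ENNReal.ofReal p *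
          ∫⁻ t, ‖f (p * t)‖ₑ ^ 2 * ENNReal.ofReal (v (p * t) ^ 2)) := by
          rw [← mul_assoc, ← ENNReal.ofReal_mul (by positivity), inv_mul_cancel₀ hp0.ne',
            ENNReal.ofReal_one, one_mul]
          rfl
      _ ≤ ENNReal.ofReal p⁻¹ * ENNReal.ofReal (v 1 ^ 2 * wienerNorm v f ^ 2) := by gcongr
      _ = _ := by rw [ENNReal.ofReal_mul (inv_pos.2 hp0).le]
  have htotal : ∫⁻ x, ‖f x - ψ (x / p) * dftTrigPoly f h p n (x / p)‖ₑ ^ 2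
      ≤ ENNReal.ofReal ((5 * (1 + K) * (v 1 + w 1) * (a + b)) ^ 2) := by
    rw [lintegral_eq_mul_lintegral_comp_mul _ hp0]
    simp only [mul_div_cancel_left₀ _ hp0.ne']
    calc _ ≤ ENNReal.ofReal p * (ENNReal.ofReal (4 * (1 + K) * tailPhi v p ^ 2) *
            ENNReal.ofReal (p⁻¹ * (v 1 ^ 2 * wienerNorm v f ^ 2))
          + ENNReal.ofReal (4 * K) *
            ENNReal.ofReal (p⁻¹ * (4 * v 1 ^ 2 * a ^ 2 + 6 * w 1 ^ 2 * b ^ 2))) := by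
          gcongr
          refine hcore.trans ?_
          gcongr
          exact hpars.trans_le hsum
      _ = ENNReal.ofReal (4 * (1 + K) * v 1 ^ 2 * a ^ 2
          + 4 * K * (4 * v 1 ^ 2 * a ^ 2 + 6 * w 1 ^ 2 * b ^ 2)) := by
          rw [← ENNReal.ofReal_mul (by positivity), ← ENNReal.ofReal_mul (by positivity),
            ← ENNReal.ofReal_add (by positivity) (by positivity),
            ← ENNReal.ofReal_mul (by positivity), ha, hb]
          congr 1
          field_simp
      _ ≤ _ := by
          apply ENNReal.ofReal_le_ofReal
          have e1 : (0 : ℝ) ≤ v 1 ^ 2 * a ^ 2 := by positivity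
          have e2 : (0 : ℝ) ≤ w 1 ^ 2 * b ^ 2 := by positivity
          have e3 : v 1 ^ 2 * a ^ 2 + w 1 ^ 2 * b ^ 2 ≤ ((v 1 + w 1) * (a + b)) ^ 2 := by
            have h1 : v 1 ^ 2 * a ^ 2 + w 1 ^ 2 * b ^ 2 ≤ (v 1 * a + w 1 * b) ^ 2 := by
              have : 0 ≤ v 1 * a * (w 1 * b) := by positivity
              nlinarith
            refine h1.trans ?_
            gcongr
            have : 0 ≤ v 1 * b := by positivity
            have : 0 ≤ w 1 * a := by positivity
            nlinarith
          calc _ ≤ 25 * (1 + K) * (v 1 ^ 2 * a ^ 2 + w 1 ^ 2 * b ^ 2) := by nlinarith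
            _ ≤ 25 * (1 + K) ^ 2 * ((v 1 + w 1) * (a + b)) ^ 2 := by
                gcongr
                nlinarith
            _ = _ := by ring
  rw [eLpNorm_eq_lintegral_rpow_enorm_toReal (by norm_num) (by norm_num)]
  simp only [ENNReal.toReal_ofNat, ENNReal.rpow_two]
  calc _ ≤ (ENNReal.ofReal ((5 * (1 + K) * (v 1 + w 1) * (a + b)) ^ 2)) ^ (1 / (2 : ℝ)) := by
        gcongr
    _ = _ := by
        rw [ENNReal.ofReal_pow (by positivity), ← ENNReal.rpow_two, ← ENNReal.rpow_mul]
        norm_num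

/-! ### Polynomial weights -/

theorem isAdmissibleWeight_polyWeight {α : ℝ} (hα : 1 / 2 < α) :
    IsAdmissibleWeight (polyWeight α) where
  pos x := by unfold polyWeight; positivity
  even x := by simp [polyWeight]
  mono x y hxy := by
    unfold polyWeight
    gcongr
  submul x y := by
    unfold polyWeight
    rw [← Real.mul_rpow (by positivity) (by positivity)]
    gcongr
    nlinarith [abs_add_le x y, abs_nonneg x, abs_nonneg y, mul_nonneg (abs_nonneg x) (abs_nonneg y)]
  summable_inv_sq := by
    have h1 : Summable fun n : ℕ => (((n : ℝ) + 1) ^ (2 * α))⁻¹ := by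
      have := (Real.summable_nat_rpow_inv (p := 2 * α)).2 (by linarith)
      simpa using (summable_nat_add_iff 1).2 this
    have e : ∀ x : ℝ, (polyWeight α x ^ 2)⁻¹ = ((|x| + 1) ^ (2 * α))⁻¹ := by
      intro x
      rw [polyWeight, ← Real.rpow_natCast, ← Real.rpow_mul (by positivity), add_comm, mul_comm]
      norm_num
    simp only [e]
    refine Summable.of_nat_of_neg ?_ ?_ <;> simpa using h1

/-- For the polynomial weight the quantity `|t| ^ α` on the central cell is dominated by
`tailPhi * polyWeight`, because `|t| * (1 + p / 2) ≤ 1 + p * |t|` for `|t| ≤ 1 / 2`. -/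
theorem abs_rpow_le_tailPhi {α : ℝ} (hα : 1 / 2 < α) {p : ℝ} (hp : 1 ≤ p) {t : ℝ}
    (ht : |t| ≤ 1 / 2) :
    (|t| ^ α) ^ 2 ≤ tailPhi (polyWeight α) p ^ 2 * polyWeight α (p * t) ^ 2 := by
  have h1 := (isAdmissibleWeight_polyWeight hα).two_mul_inv_sq_le_tailPhi_sq hp
  have hpos : 0 < polyWeight α (p / 2) := (isAdmissibleWeight_polyWeight hα).pos _
  have h2 : |t| ^ α * polyWeight α (p / 2) ≤ polyWeight α (p * t) := by
    unfold polyWeight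
    rw [← Real.mul_rpow (by positivity) (by positivity), abs_of_nonneg (by linarith : 0 ≤ p / 2),
      abs_mul, abs_of_nonneg (by linarith : 0 ≤ p)]
    gcongr
    nlinarith [abs_nonneg t]
  have h3 : (polyWeight α (p / 2) ^ 2)⁻¹ ≤ tailPhi (polyWeight α) p ^ 2 := by
    have : 0 ≤ (polyWeight α (p / 2) ^ 2)⁻¹ := by positivity
    linarith
  calc (|t| ^ α) ^ 2 = (polyWeight α (p / 2) ^ 2)⁻¹ * (|t| ^ α * polyWeight α (p / 2)) ^ 2 := by
        field_simp
    _ ≤ _ := by gcongr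

/-! ### The interpolation kernels -/

theorem isPeriodizationKernel_polyWeight {α : ℝ} (hα : 1 / 2 < α) {ψ : ℝ → ℝ}
    (hψ : Measurable ψ) {A : ℝ} (h0 : ∀ t, |t| ≤ 1 / 2 → |1 - ψ t| ≤ A * |t| ^ α)
    (h1 : ∀ t, |t| ≤ 1 / 2 → ∀ m : ℤ, m ≠ 0 → |ψ (t + m)| ≤ A * |t| ^ α / |(m : ℝ)|) :
    IsPeriodizationKernel (polyWeight α) ψ
      (2 + 2 * A ^ 2 * (1 + ∑' m : ℤ, 1 / (m : ℝ) ^ 2)) := by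
  have hS : Summable fun m : ℤ => 1 / (m : ℝ) ^ 2 :=
    Real.summable_one_div_int_pow.2 (by norm_num)
  set S := ∑' m : ℤ, 1 / (m : ℝ) ^ 2 with hSdef
  have hS0 : 0 ≤ S := tsum_nonneg fun m => by positivity
  have habs : ∀ t ∈ Ioc (-(1 / 2) : ℝ) (1 / 2), |t| ≤ 1 / 2 := fun t ht =>
    abs_le.2 ⟨ht.1.le, ht.2⟩
  have hen : ∀ x : ℝ, ‖x‖ₑ ^ 2 = ENNReal.ofReal (|x| ^ 2) := fun x => by
    rw [← ofReal_norm, Real.norm_eq_abs, ENNReal.ofReal_pow (abs_nonneg x)]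
  have hdev : ∀ t, |t| ≤ 1 / 2 → ‖1 - ψ t‖ₑ ^ 2 ≤ ENNReal.ofReal (A ^ 2 * (|t| ^ α) ^ 2) := by
    intro t ht
    rw [hen, ← mul_pow]
    exact ENNReal.ofReal_le_ofReal (pow_le_pow_left₀ (abs_nonneg _) (h0 t ht) 2)
  have htail : ∀ t, |t| ≤ 1 / 2 → ∑' m : ℤ, (if m = 0 then 0 else ‖ψ (t + m)‖ₑ ^ 2)
      ≤ ENNReal.ofReal (A ^ 2 * (|t| ^ α) ^ 2 * S) := by
    intro t ht
    rw [ENNReal.ofReal_mul (by positivity), ENNReal.ofReal_tsum_of_nonneg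
      (fun m => by positivity) hS, ← ENNReal.tsum_mul_left]
    refine ENNReal.tsum_le_tsum fun m => ?_
    split_ifs with hm
    · simp
    rw [hen, ← ENNReal.ofReal_mul (by positivity)]
    apply ENNReal.ofReal_le_ofReal
    refine (pow_le_pow_left₀ (abs_nonneg _) (h1 t ht m hm) 2).trans (le_of_eq ?_)
    rw [div_pow, sq_abs, mul_pow]
    ring
  have hsmall : ∀ t : ℝ, |t| ≤ 1 / 2 → (|t| ^ α) ^ 2 ≤ 1 := fun t ht =>
    pow_le_one₀ (by positivity) (Real.rpow_le_one (abs_nonneg t) (by linarith) (by linarith))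
  refine ⟨hψ, by positivity, fun p hp t ht => ?_, fun t ht => ?_⟩
  · refine (add_le_add (hdev t (habs t ht)) (htail t (habs t ht))).trans ?_
    rw [← ENNReal.ofReal_add (by positivity) (by positivity),
      ← ENNReal.ofReal_mul (by positivity), ← ENNReal.ofReal_mul (by positivity)]
    apply ENNReal.ofReal_le_ofReal
    have := abs_rpow_le_tailPhi hα hp (habs t ht)
    calc _ = A ^ 2 * (1 + S) * (|t| ^ α) ^ 2 := by ring
      _ ≤ (2 + 2 * A ^ 2 * (1 + S)) * (|t| ^ α) ^ 2 := by
          gcongr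
          nlinarith [mul_nonneg (sq_nonneg A) (by linarith : 0 ≤ 1 + S)]
      _ ≤ (2 + 2 * A ^ 2 * (1 + S)) *
          (tailPhi (polyWeight α) p ^ 2 * polyWeight α (p * t) ^ 2) := by gcongr
      _ = _ := by ring
  · have hsplit : ∑' m : ℤ, ‖ψ (t + m)‖ₑ ^ 2
        = ‖ψ t‖ₑ ^ 2 + ∑' m : ℤ, (if m = 0 then 0 else ‖ψ (t + m)‖ₑ ^ 2) := by
      rw [ENNReal.tsum_eq_add_tsum_ite 0, Int.cast_zero, add_zero]
      congr!
    have hψt : ‖ψ t‖ₑ ^ 2 ≤ 2 * 1 + 2 * ‖1 - ψ t‖ₑ ^ 2 := by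
      have := enorm_sub_sq_le (1 : ℝ) (1 - ψ t)
      rw [sub_sub_cancel] at this
      simpa using this
    rw [hsplit]
    calc _ ≤ 2 * 1 + 2 * ENNReal.ofReal (A ^ 2 * (|t| ^ α) ^ 2)
          + ENNReal.ofReal (A ^ 2 * (|t| ^ α) ^ 2 * S) := by
          refine add_le_add (hψt.trans ?_) (htail t (habs t ht))
          gcongr
          exact hdev t (habs t ht)
      _ = ENNReal.ofReal (2 + 2 * (A ^ 2 * (|t| ^ α) ^ 2) + A ^ 2 * (|t| ^ α) ^ 2 * S) := by
          rw [ENNReal.ofReal_add (by positivity) (by positivity),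
            ENNReal.ofReal_add (by positivity) (by positivity), ENNReal.ofReal_mul zero_le_two]
          simp
      _ ≤ _ := by
          apply ENNReal.ofReal_le_ofReal
          have h2 := hsmall t (habs t ht)
          have h3 : A ^ 2 * (|t| ^ α) ^ 2 ≤ A ^ 2 * 1 := by gcongr
          have h4 : A ^ 2 * (|t| ^ α) ^ 2 * S ≤ A ^ 2 * 1 * S := by gcongr
          have h5 : 0 ≤ A ^ 2 * S := by positivity
          nlinarith

theorem isPeriodizationKernel_indicator (v : ℝ → ℝ) :
    IsPeriodizationKernel v ((Ioc (-(1 / 2) : ℝ) (1 / 2)).indicator fun _ => 1) 1 := by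
  have hne : ∀ t ∈ Ioc (-(1 / 2) : ℝ) (1 / 2), ∀ m : ℤ, m ≠ 0 →
      t + m ∉ Ioc (-(1 / 2) : ℝ) (1 / 2) := by
    intro t ht m hm hmem
    have h1 : (m : ℝ) < 1 := by linarith [ht.1, hmem.2]
    have h2 : (-1 : ℝ) < m := by linarith [ht.2, hmem.1]
    have h3 : m < 1 := by exact_mod_cast h1
    have h4 : -1 < m := by exact_mod_cast h2
    omega
  refine ⟨measurable_const.indicator measurableSet_Ioc, zero_le_one, fun p _ t ht => ?_,
    fun t ht => ?_⟩
  · rw [indicator_of_mem ht, ENNReal.tsum_eq_zero.2]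
    · simp
    · intro m
      split_ifs with hm
      · rfl
      · rw [indicator_of_notMem (hne t ht m hm)]; simp
  · rw [tsum_eq_single 0]
    · rw [Int.cast_zero, add_zero, indicator_of_mem ht]; simp
    · intro m hm
      rw [indicator_of_notMem (hne t ht m hm)]; simp

theorem abs_one_sub_sinc_le (x : ℝ) : |1 - Real.sinc x| ≤ 2 * x ^ 2 := by
  wlog hx : 0 ≤ x generalizing x
  · have := this (-x) (by linarith)
    rwa [Real.sinc_neg, neg_sq] at this
  rcases hx.eq_or_lt with rfl | hx
  · simp
  rw [abs_of_nonneg (sub_nonneg.2 (Real.sinc_le_one x))]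
  rcases le_or_gt x 1 with h1 | h1
  · have h2 := Real.sin_gt_sub_cube hx
    have h3 : 1 - x ^ 2 / 6 ≤ Real.sinc x := by
      rw [Real.sinc_of_ne_zero hx.ne', le_div_iff₀ hx]
      nlinarith
    nlinarith
  · have := Real.neg_one_le_sinc x
    nlinarith

theorem abs_one_sub_cardinalSinc_le (t : ℝ) : |1 - cardinalSinc t| ≤ 20 * t ^ 2 := by
  refine (abs_one_sub_sinc_le _).trans ?_
  have h1 : Real.pi ^ 2 ≤ 10 := by nlinarith [Real.pi_lt_d2, Real.pi_pos]
  rw [mul_pow]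
  nlinarith [sq_nonneg t]

/-- The numerator `sin (π (t + m)) = ± sin (π t)` is `O(|t|)`, and `|t + m| ≥ |m| / 2`. -/
theorem abs_cardinalSinc_add_int_le {t : ℝ} (ht : |t| ≤ 1 / 2) {m : ℤ} (hm : m ≠ 0) :
    |cardinalSinc (t + m)| ≤ 2 * |t| / |(m : ℝ)| := by
  have hm1 : (1 : ℝ) ≤ |(m : ℝ)| := by exact_mod_cast Int.one_le_abs hm
  have h1 : |(m : ℝ)| ≤ 2 * |t + m| := by
    have : |(m : ℝ)| ≤ |t + m| + |t| := by
      have := abs_sub (t + m) t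
      simpa using this
    linarith
  have hpos : 0 < |t + m| := by linarith
  have hne : Real.pi * (t + m) ≠ 0 := mul_ne_zero Real.pi_ne_zero (abs_pos.1 hpos)
  have h2 : |Real.sin (Real.pi * (t + m))| = |Real.sin (Real.pi * t)| := by
    rw [mul_add, mul_comm Real.pi (m : ℝ), Real.sin_add_int_mul_pi, abs_mul]
    simp
  have h3 : |Real.sin (Real.pi * t)| ≤ Real.pi * |t| := by
    refine Real.abs_sin_le_abs.trans ?_
    rw [abs_mul, abs_of_pos Real.pi_pos]
  rw [cardinalSinc, Real.sinc_of_ne_zero hne, abs_div, h2, abs_mul, abs_of_pos Real.pi_pos]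
  have hπ := Real.pi_pos
  rw [div_le_div_iff₀ (by positivity) (by linarith)]
  calc _ ≤ (Real.pi * |t|) * (2 * |t + m|) := by gcongr
    _ = _ := by ring

theorem continuous_cardinalSinc : Continuous cardinalSinc :=
  Real.continuous_sinc.comp (by fun_prop)

theorem isPeriodizationKernel_cardinalSinc {α : ℝ} (hα : 1 / 2 < α) (hα1 : α ≤ 1) :
    ∃ K, IsPeriodizationKernel (polyWeight α) cardinalSinc K := by
  have hle : ∀ t : ℝ, |t| ≤ 1 / 2 → |t| ≤ |t| ^ α := fun t ht =>
    Real.self_le_rpow_of_le_one (abs_nonneg t) (by linarith) hα1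
  refine ⟨_, isPeriodizationKernel_polyWeight hα continuous_cardinalSinc.measurable
    (A := 20) (fun t ht => ?_) fun t ht m hm => ?_⟩
  · refine (abs_one_sub_cardinalSinc_le t).trans ?_
    have := hle t ht
    rw [← sq_abs]
    nlinarith [abs_nonneg t]
  · refine (abs_cardinalSinc_add_int_le ht hm).trans ?_
    have := hle t ht
    gcongr
    norm_num

theorem isPeriodizationKernel_cardinalSinc_sq {α : ℝ} (hα : 1 / 2 < α) (hα2 : α ≤ 2) :
    ∃ K, IsPeriodizationKernel (polyWeight α) (fun t => cardinalSinc t ^ 2) K := by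
  have hle : ∀ t : ℝ, |t| ≤ 1 / 2 → |t| ^ 2 ≤ |t| ^ α := fun t ht => by
    rw [← Real.rpow_two]
    exact Real.rpow_le_rpow_of_exponent_ge_of_imp (abs_nonneg t) (by linarith) hα2
      (fun _ h => absurd h (by linarith))
  refine ⟨_, isPeriodizationKernel_polyWeight hα (continuous_cardinalSinc.pow 2).measurable
    (A := 40) (fun t ht => ?_) fun t ht m hm => ?_⟩
  · change |1 - cardinalSinc t ^ 2| ≤ _
    have h1 := abs_one_sub_cardinalSinc_le t
    have h2 := hle t ht
    have h3 : |1 + cardinalSinc t| ≤ 2 := by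
      refine (abs_add_le _ _).trans ?_
      have := Real.abs_sinc_le_one (Real.pi * t)
      rw [abs_one]
      unfold cardinalSinc
      linarith
    rw [show 1 - cardinalSinc t ^ 2 = (1 - cardinalSinc t) * (1 + cardinalSinc t) by ring, abs_mul]
    calc _ ≤ 20 * t ^ 2 * 2 := by gcongr
      _ = 40 * |t| ^ 2 := by rw [sq_abs]; ring
      _ ≤ _ := by gcongr
  · change |cardinalSinc (t + m) ^ 2| ≤ _
    have h1 := abs_cardinalSinc_add_int_le ht hm
    have h2 := hle t ht
    have hm1 : (1 : ℝ) ≤ |(m : ℝ)| := by exact_mod_cast Int.one_le_abs hm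
    rw [abs_pow]
    calc _ ≤ (2 * |t| / |(m : ℝ)|) ^ 2 := by gcongr
      _ = 4 * |t| ^ 2 / |(m : ℝ)| ^ 2 := by ring
      _ ≤ 4 * |t| ^ 2 / |(m : ℝ)| := by
          gcongr
          nlinarith
      _ ≤ _ := by gcongr; norm_num

/-! ### Fourier transforms of the kernels -/

theorem integral_exp_Icc_half (c : ℝ) :
    ∫ x in (-(1 / 2) : ℝ)..(1 / 2), Complex.exp ((c * x : ℝ) * Complex.I)
      = Real.sinc (c / 2) := by
  rcases eq_or_ne c 0 with rfl | hc
  · norm_num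
  have h1 := intervalIntegral.smul_integral_comp_mul_left (a := -(1 / 2)) (b := 1 / 2)
    (fun x : ℝ => Complex.exp (x * Complex.I)) c
  have h2 := integral_exp_mul_I_eq_sinc (c / 2)
  rw [show c * -(1 / 2) = -(c / 2) by ring, show c * (1 / 2) = c / 2 by ring, h2,
    Complex.real_smul] at h1
  have hc' : (c : ℂ) ≠ 0 := by exact_mod_cast hc
  apply mul_left_cancel₀ hc'
  rw [h1]
  push_cast
  ring

theorem integral_one_sub_mul_exp {c : ℝ} (hc : c ≠ 0) :
    ∫ x in (0 : ℝ)..1, ((1 - x : ℝ) : ℂ) * Complex.exp ((c * x : ℝ) * Complex.I)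
      = -(Complex.exp (c * Complex.I) - 1 - c * Complex.I) / (c : ℂ) ^ 2 := by
  have hc' : (c : ℂ) ≠ 0 := by exact_mod_cast hc
  have hI := Complex.I_sq
  -- An antiderivative is `((1 - x) / (ic) + 1 / (ic)²) e^{icx}`.
  have hd : ∀ x : ℝ, HasDerivAt (fun x : ℝ =>
      (-(1 - (x : ℂ)) * Complex.I / c - 1 / (c : ℂ) ^ 2) * Complex.exp ((c * x : ℝ) * Complex.I))
      (((1 - x : ℝ) : ℂ) * Complex.exp ((c * x : ℝ) * Complex.I)) x := by
    intro x
    have h1 : HasDerivAt (fun x : ℝ => (x : ℂ)) 1 x := Complex.ofRealCLM.hasDerivAt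
    have h2 : HasDerivAt (fun x : ℝ => ((c * x : ℝ) : ℂ) * Complex.I) (c * Complex.I) x := by
      have := (h1.const_mul (c : ℂ)).mul_const Complex.I
      simpa using this
    have h3 := ((((h1.const_sub 1).neg.mul_const Complex.I).div_const (c : ℂ)).sub_const
      (1 / (c : ℂ) ^ 2)).mul h2.cexp
    refine h3.congr_deriv ?_
    simp only [Pi.neg_apply]
    push_cast
    field_simp
    linear_combination (-(1 - (x : ℂ)) * c) * hI
  rw [intervalIntegral.integral_eq_sub_of_hasDerivAt (fun x _ => hd x)
    (Continuous.intervalIntegrable (by fun_prop) _ _)]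
  simp
  field_simp
  ring

theorem integral_one_sub_abs_mul_exp (c : ℝ) :
    ∫ x in (-1 : ℝ)..1, ((1 - |x| : ℝ) : ℂ) * Complex.exp ((c * x : ℝ) * Complex.I)
      = (Real.sinc (c / 2) ^ 2 : ℝ) := by
  have hcont : Continuous fun x : ℝ =>
      ((1 - |x| : ℝ) : ℂ) * Complex.exp ((c * x : ℝ) * Complex.I) := by fun_prop
  have hpos : ∀ c : ℝ, ∫ x in (0 : ℝ)..1, ((1 - |x| : ℝ) : ℂ) *
      Complex.exp ((c * x : ℝ) * Complex.I)
      = ∫ x in (0 : ℝ)..1, ((1 - x : ℝ) : ℂ) * Complex.exp ((c * x : ℝ) * Complex.I) := by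
    intro c
    refine intervalIntegral.integral_congr fun x hx => ?_
    rw [uIcc_of_le zero_le_one] at hx
    simp only [abs_of_nonneg hx.1]
  have hneg : ∫ x in (-1 : ℝ)..0, ((1 - |x| : ℝ) : ℂ) * Complex.exp ((c * x : ℝ) * Complex.I)
      = ∫ x in (0 : ℝ)..1, ((1 - |x| : ℝ) : ℂ) * Complex.exp ((-c * x : ℝ) * Complex.I) := by
    have := intervalIntegral.integral_comp_neg (a := (0 : ℝ)) (b := 1) (fun x : ℝ =>
      ((1 - |x| : ℝ) : ℂ) * Complex.exp ((c * x : ℝ) * Complex.I))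
    rw [neg_zero] at this
    rw [← this]
    simp
  rw [← intervalIntegral.integral_add_adjacent_intervals (b := 0) (hcont.intervalIntegrable _ _)
    (hcont.intervalIntegrable _ _), hneg, hpos, hpos]
  rcases eq_or_ne c 0 with rfl | hc
  · simp only [neg_zero, zero_mul, Complex.ofReal_zero, Complex.exp_zero, mul_one, zero_div,
      Real.sinc_zero, intervalIntegral.integral_ofReal]
    have h1 : ∫ x in (0 : ℝ)..1, (1 - x) = 1 / 2 := by
      rw [intervalIntegral.integral_sub (by simp) (by simp)]
      norm_num
    rw [h1]
    norm_num
  rw [integral_one_sub_mul_exp hc, integral_one_sub_mul_exp (neg_ne_zero.2 hc),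
    Real.sinc_of_ne_zero (by positivity)]
  have hc' : (c : ℂ) ≠ 0 := by exact_mod_cast hc
  have hcos : Complex.exp (c * Complex.I) + Complex.exp (-(c * Complex.I))
      = 2 - 4 * Complex.sin (c / 2) ^ 2 := by
    have h1 : Complex.cos c = 1 - 2 * Complex.sin (c / 2) ^ 2 := by
      have := Complex.cos_two_mul (c / 2 : ℂ)
      rw [Complex.cos_sq', mul_div_cancel₀ _ two_ne_zero] at this
      rw [this]; ring
    rw [← neg_mul, ← Complex.two_cos, h1]; ring
  push_cast
  rw [neg_sq, div_pow]
  field_simp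
  linear_combination (-1 : ℂ) * hcos

theorem fourier_indicator_Ioc (ξ : ℝ) :
    𝓕 (fun x : ℝ => (((Ioc (-(1 / 2) : ℝ) (1 / 2)).indicator (fun _ => (1 : ℝ)) x : ℝ) : ℂ)) ξ
      = cardinalSinc ξ := by
  rw [Real.fourier_real_eq_integral_exp_smul]
  have h1 := integral_exp_Icc_half (-2 * Real.pi * ξ)
  rw [show -2 * Real.pi * ξ / 2 = -(Real.pi * ξ) by ring, Real.sinc_neg,
    intervalIntegral.integral_of_le (by norm_num), ← integral_indicator measurableSet_Ioc] at h1
  rw [cardinalSinc, ← h1]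
  congr 1 with x
  by_cases hx : x ∈ Ioc (-(1 / 2) : ℝ) (1 / 2)
  · simp only [indicator_of_mem hx]; simp [mul_right_comm]
  · simp only [indicator_of_notMem hx]; simp

theorem fourierInv_bsplineOne (x : ℝ) :
    𝓕⁻ (fun ξ : ℝ => (bsplineOne ξ : ℂ)) x = cardinalSinc x := by
  rw [Real.fourierInv_eq']
  have h1 := integral_exp_Icc_half (2 * Real.pi * x)
  rw [show 2 * Real.pi * x / 2 = Real.pi * x by ring,
    intervalIntegral.integral_of_le (by norm_num), ← integral_Ico_eq_integral_Ioc,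
    ← integral_indicator measurableSet_Ico] at h1
  rw [cardinalSinc, ← h1]
  congr 1 with ξ
  unfold bsplineOne
  by_cases hx : ξ ∈ Ico (-(1 / 2) : ℝ) (1 / 2)
  · simp only [indicator_of_mem hx]; simp [mul_assoc]
  · simp only [indicator_of_notMem hx]; simp

theorem fourierInv_bsplineTwo (x : ℝ) :
    𝓕⁻ (fun ξ : ℝ => (bsplineTwo ξ : ℂ)) x = (cardinalSinc x ^ 2 : ℝ) := by
  rw [Real.fourierInv_eq']
  have h1 := integral_one_sub_abs_mul_exp (2 * Real.pi * x)
  rw [show 2 * Real.pi * x / 2 = Real.pi * x by ring,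
    intervalIntegral.integral_of_le (by norm_num), ← integral_Icc_eq_integral_Ioc,
    ← integral_indicator measurableSet_Icc] at h1
  rw [cardinalSinc, ← h1]
  congr 1 with ξ
  unfold bsplineTwo
  by_cases hx : ξ ∈ Icc (-1 : ℝ) 1
  · simp only [indicator_of_mem hx, smul_eq_mul, RCLike.inner_apply, conj_trivial, mul_assoc]
    rw [mul_comm]
  · simp only [indicator_of_notMem hx]; simp

theorem memLp_ofReal_indicator {s : Set ℝ} (hs : MeasurableSet s) (hsb : Bornology.IsBounded s)
    {g : ℝ → ℝ} (hg : Measurable g) (hb : ∀ x ∈ s, |g x| ≤ 1) (q : ENNReal) :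
    MemLp (fun x => ((s.indicator g x : ℝ) : ℂ)) q := by
  have h1 : MemLp (s.indicator fun _ : ℝ => (1 : ℝ)) q :=
    memLp_indicator_const q hs 1 (Or.inr hsb.measure_lt_top.ne)
  refine h1.of_le (Measurable.aestronglyMeasurable
    (Complex.measurable_ofReal.comp (hg.indicator hs))) (Filter.Eventually.of_forall fun x => ?_)
  rw [Complex.norm_real]
  by_cases hx : x ∈ s
  · simpa [indicator_of_mem hx] using hb x hx
  · simp [indicator_of_notMem hx]

/-! ### The three interpolation schemes -/

theorem theorem4p1 :
    (∀ v w : ℝ → ℝ, IsAdmissibleWeight v → IsAdmissibleWeight w →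
      ∃ C : ℝ, 0 < C ∧ ∀ f : ℝ → ℂ, MemWiener v f → MemWiener w (𝓕 f) →
        ∀ (h p : ℝ) (n : ℕ), 0 < h → h ≤ 1 → 1 ≤ p → p = h * (n : ℝ) →
          MeasureTheory.eLpNorm (fun ξ : ℝ => 𝓕 f ξ - dftInterpolant cardinalSinc f h p n ξ)
              2 MeasureTheory.volume
            ≤ ENNReal.ofReal (C * (tailPhi v p * wienerNorm v f
                + tailPhi w h⁻¹ * wienerNorm w (𝓕 f)))) ∧
    (∀ (α : ℝ) (w : ℝ → ℝ), 1 / 2 < α → α ≤ 1 → IsAdmissibleWeight w →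
      ∃ C : ℝ, 0 < C ∧ ∀ f : ℝ → ℂ, MemWiener (polyWeight α) f → MemWiener w (𝓕 f) →
        ∀ (h p : ℝ) (n : ℕ), 0 < h → h ≤ 1 → 1 ≤ p → p = h * (n : ℝ) →
          MeasureTheory.eLpNorm (fun ξ : ℝ => 𝓕 f ξ - dftInterpolant bsplineOne f h p n ξ)
              2 MeasureTheory.volume
            ≤ ENNReal.ofReal (C * (tailPhi (polyWeight α) p * wienerNorm (polyWeight α) f
                + tailPhi w h⁻¹ * wienerNorm w (𝓕 f)))) ∧
    (∀ (α : ℝ) (w : ℝ → ℝ), 1 / 2 < α → α ≤ 2 → IsAdmissibleWeight w →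
      ∃ C : ℝ, 0 < C ∧ ∀ f : ℝ → ℂ, MemWiener (polyWeight α) f → MemWiener w (𝓕 f) →
        ∀ (h p : ℝ) (n : ℕ), 0 < h → h ≤ 1 → 1 ≤ p → p = h * (n : ℝ) →
          MeasureTheory.eLpNorm (fun ξ : ℝ => 𝓕 f ξ - dftInterpolant bsplineTwo f h p n ξ)
              2 MeasureTheory.volume
            ≤ ENNReal.ofReal (C * (tailPhi (polyWeight α) p * wienerNorm (polyWeight α) f
                + tailPhi w h⁻¹ * wienerNorm w (𝓕 f)))) := by
  refine ⟨fun v w hv hw => ?_, fun α w hα hα1 hw => ?_, fun α w hα hα2 hw => ?_⟩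
  · have hv1 := hv.pos 1
    have hw1 := hw.pos 1
    refine ⟨5 * (1 + 1) * (v 1 + w 1), by positivity, fun f hf hf' h p n hh hh1 hp1 hp => ?_⟩
    have hmem := memLp_ofReal_indicator (measurableSet_Ioc (a := (-(1 / 2) : ℝ)) (b := 1 / 2))
      (Metric.isBounded_Ioc _ _) (g := fun _ => 1) measurable_const (by simp)
    rw [eLpNorm_fourier_sub_dftInterpolant_of_fourier_eq (memLp_one_iff_integrable.1 (hmem 1))
      (hmem 2) fourier_indicator_Ioc (hf.integrable hv) (hf.memLp_two hv) (by linarith) n]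
    exact (isPeriodizationKernel_indicator v).eLpNorm_sub_le hv hw hf hf' hh hh1 hp1 hp
  · have hv := isAdmissibleWeight_polyWeight hα
    have hv1 := hv.pos 1
    have hw1 := hw.pos 1
    obtain ⟨K, hK⟩ := isPeriodizationKernel_cardinalSinc hα hα1
    have hK0 := hK.nonneg
    refine ⟨5 * (1 + K) * (polyWeight α 1 + w 1), by positivity,
      fun f hf hf' h p n hh hh1 hp1 hp => ?_⟩
    have hmem := memLp_ofReal_indicator (measurableSet_Ico (a := (-(1 / 2) : ℝ)) (b := 1 / 2))
      (Metric.isBounded_Ico _ _) (g := fun _ => 1) measurable_const (by simp)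
    rw [eLpNorm_fourier_sub_dftInterpolant_of_fourierInv_eq (φ := bsplineOne)
      (memLp_one_iff_integrable.1 (hmem 1)) (hmem 2) fourierInv_bsplineOne
      (fourierInv_fourier_eq_of_memWiener hv hw hf hf') (hf'.integrable hw) (hf'.memLp_two hw)
      (by linarith) n]
    exact hK.eLpNorm_sub_le hv hw hf hf' hh hh1 hp1 hp
  · have hv := isAdmissibleWeight_polyWeight hα
    have hv1 := hv.pos 1
    have hw1 := hw.pos 1
    obtain ⟨K, hK⟩ := isPeriodizationKernel_cardinalSinc_sq hα hα2
    have hK0 := hK.nonneg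
    refine ⟨5 * (1 + K) * (polyWeight α 1 + w 1), by positivity,
      fun f hf hf' h p n hh hh1 hp1 hp => ?_⟩
    have hmem := memLp_ofReal_indicator (measurableSet_Icc (a := (-1 : ℝ)) (b := 1))
      (Metric.isBounded_Icc _ _) (g := fun x => 1 - |x|) (by fun_prop) (fun x hx => by
        have h1 : |x| ≤ 1 := abs_le.2 hx
        rw [abs_of_nonneg (by linarith)]
        linarith [abs_nonneg x])
    rw [eLpNorm_fourier_sub_dftInterpolant_of_fourierInv_eq (φ := bsplineTwo)
      (memLp_one_iff_integrable.1 (hmem 1)) (hmem 2) fourierInv_bsplineTwo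
      (fourierInv_fourier_eq_of_memWiener hv hw hf hf') (hf'.integrable hw) (hf'.memLp_two hw)
      (by linarith) n]
    exact hK.eLpNorm_sub_le hv hw hf hf' hh hh1 hp1 hp
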